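/- Work over $\mathbb{Z}/2$. Let $\beta$ be a word in the Artin generators $\sigma_1^{\pm1},\dots,\sigma_{n-1}^{\pm1}$ of the braid group $B_n$, and regard its closure $\bar\beta$ as an annular link diagram. Let $CKh(\bar\beta)$ be its Khovanov complex, with basis the labellings by $v_+$, $v_-$ of the circles of the complete resolutions, and with differential $d$ given by the merge map $v_+v_+\mapsto v_+$, $v_+v_-,v_-v_+\mapsto v_-$, $v_-v_-\mapsto 0$ and the split map $v_+\mapsto v_+v_-+v_-v_+$, $v_-\mapsto v_-v_-$, summed over all changes of one $0$-resolution to a $1$-resolution. (The $0$-resolution is the braidlike one at a positive crossing, the $1$-resolution is the braidlike one at a negative crossing.) The homological grading $h$ is the number of $1$-resolved crossings, without a final shift, and $CKh_h$ is the part in grading $h$. Call a circle non-trivial if it has odd intersection number with an arc from the inner to the outer boundary of the annulus. The annular grading $k$ of a basis element is the number of its non-trivial circles labelled $v_+$ minus the number of its non-trivial circles labelled $v_-$; let $\mathcal{F}_i$ be the span of the basis elements with $k\le i$. The spectral sequence of this filtered complex, which goes from the annular Khovanov homology to the Khovanov homology $Kh$ of $\bar\beta$, has $$E^r_{h,m}=\frac{\{x\in\mathcal{F}_mCKh_h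 : dx\in\mathcal{F}_{m-r}\}}{\mathcal{F}_{m-1}CKh_h+d(\mathcal{F}_{m+r-1}CKh_{h-1})}$$ (the denominator being intersected with the numerator), with differentials $d^r:E^r_{h,m}\to E^r_{h+1,m-r}$, $[x]\mapsto[dx]$. It collapses at $E^r$ if $d^s=0$ for all $s\ge r$. Let $\psi(\bar\beta)$ be the labelling of all circles of the braidlike resolution by $v_-$, and put $\kappa(\beta)=n+\min\{i : [\psi(\bar\beta)]=0\in H(\mathcal{F}_i)\}$ if $\psi(\bar\beta)$ is a boundary, and $\kappa(\beta)=\infty$ otherwise. **Proposition.** The spectral sequence from annular Khovanov homology to Khovanov homology does not always collapse at the $E^3$ page. More precisely, let $$A=A(0,0)=\sigma_3\sigma_2^{-2}\sigma_3^{2}\sigma_2\sigma_3^{-1}\sigma_1^{-1}\sigma_2\sigma_1^{2},$$ a braid word on $4$ strands, and $\psi=\psi(\bar A)$. Then: 1. $\kappa(A)=4$; 2. $\psi$ represents a non-zero class in $E^3_{4,-4}$; 3. $\psi$ is a cycle in $CKh_4(\bar A)$ and $[\psi]=0$ in $Kh_4(\bar A)$; 4. $Kh_4(\bar A)$ is not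 isomorphic to $\bigoplus_{m=-4}^{4}E^3_{4,m}$; 5. the spectral sequence of $\bar A$ does not collapse at $E^3$. -/

import Mathlib

noncomputable section

namespace AnnularKhovanov

/-- A word in the Artin generators of the braid group on `n` strands.  The letter `(i, true)` is the
generator exchanging the strands `i` and `i + 1` (strands are numbered `0, …, n - 1`), that is
`σ_{i+1}` in the usual numbering; the letter `(i, false)` is its inverse. -/
abbrev BraidWord (n : ℕ) := List (Fin (n - 1) × Bool)

/-- The word `σ_{i+1} ^ m` for an integer `m`. -/
def genPow {n : ℕ} (i : Fin (n - 1)) (m : ℤ) : BraidWord n :=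
  List.replicate m.natAbs (i, decide (0 < m))

/-- The braid word
`A(a,b) = σ₃ σ₂⁻² σ₃^(2a+2) σ₂ σ₃⁻¹ σ₁⁻¹ σ₂ σ₁^(2b+2)` on four strands. -/
def braidA (a b : ℕ) : BraidWord 4 :=
  let σ₁ : ℤ → BraidWord 4 := genPow (n := 4) (0 : Fin 3)
  let σ₂ : ℤ → BraidWord 4 := genPow (n := 4) (1 : Fin 3)
  let σ₃ : ℤ → BraidWord 4 := genPow (n := 4) (2 : Fin 3)
  σ₃ 1 ++ σ₂ (-2) ++ σ₃ (2 * a + 2) ++ σ₂ 1 ++ σ₃ (-1) ++ σ₁ (-1) ++ σ₂ 1 ++ σ₁ (2 * b + 2)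

section Diagram

variable {n : ℕ} (w : BraidWord n)

/-- The crossings of the closed braid diagram, in the order of the word. -/
abbrev Crossing := Fin w.length

/-- Marked points on the closed braid diagram: the point `(t, j)` lies on strand position `j` at
height `t`.  The crossing number `t` lies between the heights `t` and `t + 1`. -/
abbrev Point := Fin (w.length + 1) × Fin n

variable {w}

/-- The left of the two strand positions that meet at the crossing `t`. -/
def leftPos (t : Crossing w) : Fin n := ⟨(w.get t).1, by omega⟩

/-- The right of the two strand positions that meet at the crossing `t`. -/
def rightPos (t : Crossing w) : Fin n := ⟨(w.get t).1 + 1, by omega⟩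

/-- A complete resolution: `false` is the `0`-resolution and `true` the `1`-resolution. -/
abbrev Resolution (w : BraidWord n) := Crossing w → Bool

/-- The resolution `I` smooths the crossing `t` in the braidlike (oriented) way: this is the
`0`-resolution of a positive crossing and the `1`-resolution of a negative crossing. -/
def Resolution.Braidlike (I : Resolution w) (t : Crossing w) : Prop := I t = !(w.get t).2

/-- The elementary arcs of the resolved closed braid diagram.  The arcs `closing j` are those that
close up the braid; they are the only ones which meet the curve `γ` running from the inner to
the outer boundary of the annulus, and each of them meets `γ` once. -/
inductive Arc (I : Resolution w) : Point w → Point w → Prop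
  | strand (t : Crossing w) (j : Fin n) (hl : j ≠ leftPos t) (hr : j ≠ rightPos t) :
      Arc I (t.castSucc, j) (t.succ, j)
  | through_left (t : Crossing w) (h : I.Braidlike t) :
      Arc I (t.castSucc, leftPos t) (t.succ, leftPos t)
  | through_right (t : Crossing w) (h : I.Braidlike t) :
      Arc I (t.castSucc, rightPos t) (t.succ, rightPos t)
  | turn_bottom (t : Crossing w) (h : ¬ I.Braidlike t) :
      Arc I (t.castSucc, leftPos t) (t.castSucc, rightPos t)
  | turn_top (t : Crossing w) (h : ¬ I.Braidlike t) :
      Arc I (t.succ, leftPos t) (t.succ, rightPos t)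
  | closing (j : Fin n) : Arc I (Fin.last w.length, j) (0, j)

/-- Two points are equivalent if they lie on the same component of the resolved diagram. -/
def circleSetoid (I : Resolution w) : Setoid (Point w) := Relation.EqvGen.setoid (Arc I)

/-- Two points lie on the same component of the resolved diagram. -/
def SameCircle (I : Resolution w) (x y : Point w) : Prop := (circleSetoid I).r x y

/-- The components (circles) of the resolved diagram. -/
abbrev Circle (I : Resolution w) := Quotient (circleSetoid I)

/-- A circle is non-trivial if its mod 2 intersection number with the curve `γ` is `1`. -/
def Circle.Nontrivial {I : Resolution w} (c : Circle I) : Prop :=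
  Odd {j : Fin n | (⟦((Fin.last w.length, j) : Point w)⟧ : Circle I) = c}.ncard

variable (w) in
/-- A canonical generator of the Khovanov complex: a complete resolution together with a labelling
of its circles by `v₊` (`true`) and `v₋` (`false`).  A labelling of the circles is given as a
labelling of the marked points which is constant along arcs. -/
@[ext]
structure Generator where
  res : Resolution w
  label : Point w → Bool
  label_arc : ∀ x y, Arc res x y → label x = label y

instance : Finite (Generator w) :=
  Finite.of_injective (fun S : Generator w => (S.res, S.label)) (by
    intro S T h
    simp only [Prod.mk.injEq] at h
    exact Generator.ext h.1 h.2)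

instance : Fintype (Generator w) := Fintype.ofFinite _

namespace Generator

/-- The label of a circle. -/
def circleLabel (S : Generator w) : Circle S.res → Bool :=
  Quotient.lift S.label (by
    intro x y h
    induction h with
    | rel x y h => exact S.label_arc x y h
    | refl x => rfl
    | symm x y _ ih => exact ih.symm
    | trans x y z _ _ ih₁ ih₂ => exact ih₁.trans ih₂)

/-- The annular grading: the number of non-trivial circles labelled `v₊` minus the number of
non-trivial circles labelled `v₋`. -/
def k (S : Generator w) : ℤ :=
  ({c : Circle S.res | c.Nontrivial ∧ S.circleLabel c = true}.ncard : ℤ) -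
    ({c : Circle S.res | c.Nontrivial ∧ S.circleLabel c = false}.ncard : ℤ)

/-- The homological grading before any final shift: the number of `1`-resolved crossings. -/
def h (S : Generator w) : ℤ := ({t : Crossing w | S.res t = true}.ncard : ℤ)

end Generator

/-- `v_z` occurs in the product `m(v_x ⊗ v_y)`, where `m(v₊ ⊗ v₊) = v₊`,
`m(v₊ ⊗ v₋) = m(v₋ ⊗ v₊) = v₋` and `m(v₋ ⊗ v₋) = 0`. -/
def MergeRule : Bool → Bool → Bool → Prop
  | true, true, z => z = true
  | true, false, z => z = false
  | false, true, z => z = false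
  | false, false, _ => False

/-- `v_x ⊗ v_y` occurs in the coproduct `Δ(v_z)`, where `Δ(v₊) = v₊ ⊗ v₋ + v₋ ⊗ v₊` and
`Δ(v₋) = v₋ ⊗ v₋`. -/
def SplitRule : Bool → Bool → Bool → Prop
  | true, x, y => x ≠ y
  | false, x, y => x = false ∧ y = false

/-- `T` occurs in the differential of `S`, along the edge of the cube which changes the resolution
of the crossing `t` from `0` to `1`.  The points `p` and `q` are opposite corners of the crossing
`t`; in either resolution of `t` they lie on different local arcs, so the circles through the
crossing are those of `p` and `q`.  If these are different circles of `S`, then they are merged;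
otherwise the one circle through the crossing is split.  All other circles keep their labels. -/
def IncidentAt (t : Crossing w) (S T : Generator w) : Prop :=
  let p : Point w := (t.castSucc, leftPos t)
  let q : Point w := (t.succ, rightPos t)
  S.res t = false ∧ T.res = Function.update S.res t true ∧
  (∀ x, ¬ SameCircle S.res x p → ¬ SameCircle S.res x q → T.label x = S.label x) ∧
  (¬ SameCircle S.res p q → MergeRule (S.label p) (S.label q) (T.label p)) ∧
  (SameCircle S.res p q → SplitRule (S.label p) (T.label p) (T.label q))

variable (w)

/-- The Khovanov chain group over `ℤ/2` of the closed braid diagram.  A chain is given by its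
coefficients on the (finitely many) canonical generators. -/
abbrev CKh := Generator w → ZMod 2

open Classical in
/-- The Khovanov differential: the coefficient of `T` in `d x` is the sum of the coefficients in
`x` of all generators `S` for which `T` occurs in `d S`. -/
def diff : CKh w →ₗ[ZMod 2] CKh w where
  toFun x := fun T => ∑ S : Generator w with ∃ t, IncidentAt t S T, x S
  map_add' x y := by
    funext T
    simp [Finset.sum_add_distrib]
  map_smul' c x := by
    funext T
    simp [Finset.mul_sum]

variable {w} in
/-- The span of the canonical generators that satisfy `P`. -/
def spanOf (P : Generator w → Prop) : Submodule (ZMod 2) (CKh w) where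
  carrier := {x | ∀ S, ¬ P S → x S = 0}
  add_mem' hx hy S hS := by simp [hx S hS, hy S hS]
  zero_mem' S _ := rfl
  smul_mem' c x hx S hS := by simp [hx S hS]

/-- `CKh_h`, the span of the generators of homological grading `h`. -/
def CKhDeg (h : ℤ) : Submodule (ZMod 2) (CKh w) := spanOf fun S => S.h = h

/-- The annular filtration `𝓕_i`, the span of the generators with `k ≤ i`. -/
def filt (i : ℤ) : Submodule (ZMod 2) (CKh w) := spanOf fun S => S.k ≤ i

/-- The cycles of Khovanov homology in homological grading `h`. -/
def cycles (h : ℤ) : Submodule (ZMod 2) (CKh w) := CKhDeg w h ⊓ LinearMap.ker (diff w)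

/-- Khovanov homology over `ℤ/2` in homological grading `h` (before any final shift). -/
abbrev Kh (h : ℤ) : Type :=
  ↥(cycles w h) ⧸ ((CKhDeg w (h - 1)).map (diff w)).submoduleOf (cycles w h)

/-- The chains `{x ∈ 𝓕_m CKh_h | d x ∈ 𝓕_{m-r}}` which represent elements of `E^r_{h,m}`. -/
def pageNum (r : ℕ) (h m : ℤ) : Submodule (ZMod 2) (CKh w) :=
  (filt w m ⊓ CKhDeg w h) ⊓ (filt w (m - r)).comap (diff w)

/-- The chains `𝓕_{m-1} CKh_h + d (𝓕_{m+r-1} CKh_{h-1})`, which represent zero in `E^r_{h,m}`. -/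
def pageDen (r : ℕ) (h m : ℤ) : Submodule (ZMod 2) (CKh w) :=
  (filt w (m - 1) ⊓ CKhDeg w h) ⊔ (filt w (m + r - 1) ⊓ CKhDeg w (h - 1)).map (diff w)

/-- The term `E^r_{h,m}`, in homological grading `h` and annular grading `m`, of the spectral
sequence of the filtered complex `CKh`, i.e. of the spectral sequence from annular Khovanov
homology to Khovanov homology. -/
abbrev Page (r : ℕ) (h m : ℤ) : Type :=
  ↥(pageNum w r h m) ⧸ (pageDen w r h m).submoduleOf (pageNum w r h m)

/-- The differential `d^r : E^r_{h,m} → E^r_{h+1,m-r}`, `[x] ↦ [d x]`, is zero. -/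
def DifferentialVanishes (r : ℕ) (h m : ℤ) : Prop :=
  ∀ x ∈ pageNum w r h m, diff w x ∈ pageDen w r (h + 1) (m - r)

/-- The spectral sequence collapses at the page `E^r`: all differentials `d^s` with `s ≥ r` are
zero. -/
def CollapsesAt (r : ℕ) : Prop :=
  ∀ s : ℕ, r ≤ s → ∀ h m : ℤ, DifferentialVanishes w s h m

/-- Plamenevskaya's generator: every circle of the braidlike resolution is labelled `v₋`. -/
def psiGen : Generator w where
  res := fun t => !(w.get t).2
  label := fun _ => false
  label_arc := fun _ _ _ => rfl

open Classical in
/-- Plamenevskaya's element `ψ`. -/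
def psi : CKh w := Pi.single (psiGen w) 1

/-- `ψ` lies in `𝓕_i` and its class in the homology of the complex `𝓕_i` is zero. -/
def PsiVanishesIn (i : ℤ) : Prop := psi w ∈ filt w i ∧ psi w ∈ (filt w i).map (diff w)

open Classical in
/-- `κ = n + min {i | [ψ] = 0 ∈ H(𝓕_i)}`, or `∞` if `ψ` is not a boundary.  The set of such `i` is
bounded below, as `ψ ∈ 𝓕_i` forces `-n ≤ i`. -/
def kappa : WithTop ℤ :=
  if psi w ∈ LinearMap.range (diff w) then
    (((n : ℤ) + sInf {i : ℤ | PsiVanishesIn w i} : ℤ) : WithTop ℤ)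
  else ⊤

end Diagram

end AnnularKhovanov

end

/-! Everything follows from two facts about ψ: it is the boundary of a chain x in 𝓕₀ ∩ CKh₃, and it
is not the boundary of any chain in 𝓕₋₁. On four strands -4 is the lowest possible annular grading,
and ψ has it. Hence 𝓕₋₅ = 0, and a chain represents zero in E^r_{4,-4} only if it lies in d(𝓕_{r-5}
CKh₃). For r ≤ 4 this is contained in d(𝓕₋₁), so ψ is non-zero in E³ and E⁴, and d⁴[x] = [ψ] is a
non-zero differential out of E⁴_{3,0}. The same two facts give κ = 4 + 0. For the comparison with
Kh₄, each graded piece of the filtration induced on homology is a subquotient of the corresponding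
E^r term. The class of ψ is present in E³_{4,-4} but dies in Kh₄, so the total dimension of E³ is
strictly larger (`finrank_kh_lt_sum_finrank_page`, `consequences_of_psi_boundary`).

The first fact is witnessed by an explicit x with eleven terms. The second is witnessed by duality:
there is a cochain φ with ⟨φ, ψ⟩ = 1 whose transposed differential d*φ involves only generators with
k ≥ 0, so ⟨φ, dy⟩ = ⟨d*φ, y⟩ = 0 for all y in 𝓕₋₁ (`psi_notMem_map_filt`). Both witnesses are
checked by kernel evaluation on generators encoded as bit masks; `diff_indSum`,
`indSum_dotProduct_diff`, `Decodes.h_eq` and `Decodes.k_eq` justify the encoding.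

Two general properties of the cube of resolutions are needed. Changing a crossing merges two circles
or splits one (`DifferAt.sameCircle_corner_iff`): circles are the cycles of a permutation, and the
change multiplies it by a transposition. And d² = 0 (`diff_diff`): if coefficients are regarded as
functions of sets of points labelled v₊, a split acts as the identity and a merge as the sum of two
commuting operators. -/

noncomputable section

namespace AnnularKhovanov

/-! ### Cycles of a permutation times a transposition. -/

section Permutations

open Equiv Equiv.Perm

/-- The orbit of `a` closes up after `k` steps, so it consists of the points seen before that time.
-/
theorem not_sameCycle_of_return {α : Type*} [Finite α] {f : Perm α} {a b : α} {k : ℕ} (hk : 0 < k)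
    (ha : (f ^ k) a = a) (hb : ∀ i, 0 < i → i < k → (f ^ i) a ≠ b) (hab : a ≠ b) :
    ¬ SameCycle f a b := by
  intro h
  obtain ⟨m, hm⟩ := h.exists_nat_pow_eq
  have hper : ∀ l : ℕ, (f ^ (k * l)) a = a := by
    intro l
    induction l with
    | zero => simp
    | succ l ih => rw [Nat.mul_succ, pow_add, Perm.mul_apply, ha, ih]
  have h2 : (f ^ (m % k)) a = b := by
    rw [← hm]
    conv_rhs => rw [← Nat.mod_add_div m k, pow_add, Perm.mul_apply, hper]
  rcases Nat.eq_zero_or_pos (m % k) with h0 | h0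
  · rw [h0] at h2; exact hab (by simpa using h2)
  · exact hb _ h0 (Nat.mod_lt _ hk) h2

/-- Multiplying a permutation by a transposition merges two cycles or splits one. -/
theorem sameCycle_mul_swap_iff {α : Type*} [Finite α] [DecidableEq α] (f : Perm α) {p q : α}
    (hpq : p ≠ q) : SameCycle (f * swap p q) p q ↔ ¬ SameCycle f p q := by
  classical
  set g := f * swap p q with hg
  have hex : ∃ k, 0 < k ∧ ((f ^ k) q = p ∨ (f ^ k) q = q) :=
    ⟨orderOf f, orderOf_pos f, Or.inr (by rw [pow_orderOf_eq_one]; rfl)⟩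
  obtain ⟨hk, hkq⟩ := Nat.find_spec hex
  set k := Nat.find hex with hkdef
  have hmin : ∀ i, 0 < i → i < k → (f ^ i) q ≠ p ∧ (f ^ i) q ≠ q := by
    intro i hi hik
    have := Nat.find_min hex hik
    push Not at this
    exact this hi
  -- Up to the first return of the `f`-orbit of `q` to `{p, q}`, the `g`-orbit of `p` follows the
  -- same path, as the swap acts only at `p` and `q`. Returning to `p` means one cycle for `f` and
  -- two for `g`; returning to `q` means the opposite.
  have hgi : ∀ i, i < k → (g ^ (i + 1)) p = (f ^ (i + 1)) q := by
    intro i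
    induction i with
    | zero => intro _; simp [hg]
    | succ i ih =>
      intro hik
      rw [pow_succ', Perm.mul_apply, ih (by omega), pow_succ' f (i + 1), Perm.mul_apply]
      simp only [Perm.mul_apply]
      rw [swap_apply_of_ne_of_ne (hmin (i + 1) (by omega) hik).1 (hmin (i + 1) (by omega) hik).2]
  have hgk : (g ^ k) p = (f ^ k) q := by
    have := hgi (k - 1) (by omega)
    rwa [Nat.sub_add_cancel hk] at this
  rcases hkq with h | h
  · have h1 : SameCycle f p q := SameCycle.symm ⟨k, by simpa using h⟩
    have h2 : ¬ SameCycle g p q :=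
      not_sameCycle_of_return hk (hgk.trans h) (fun i hi hik => by
        have := hgi (i - 1) (by omega)
        rw [Nat.sub_add_cancel hi] at this
        rw [this]
        exact (hmin i hi hik).2) hpq
    tauto
  · have h1 : ¬ SameCycle f q p :=
      not_sameCycle_of_return hk h (fun i hi hik => (hmin i hi hik).1) hpq.symm
    have h2 : SameCycle g p q := ⟨k, by simpa using hgk.trans h⟩
    rw [sameCycle_comm] at h1
    tauto

end Permutations

/-! ### Circles as cycles of a permutation, and the effect of changing one crossing. -/

section Edge

variable {n : ℕ} {w : BraidWord n}

theorem rightPos_val (t : Crossing w) : (rightPos t).val = (leftPos t).val + 1 := rfl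

theorem rightPos_ne_leftPos (t : Crossing w) : rightPos t ≠ leftPos t := by
  intro h
  have := congrArg Fin.val h
  rw [rightPos_val] at this
  omega

/-- The crossing below a positive height. -/
def prevCrossing (s : Fin (w.length + 1)) (h : 0 < s.val) : Crossing w := ⟨s.val - 1, by omega⟩

theorem prevCrossing_succ (t : Crossing w) (h : 0 < t.succ.val) : prevCrossing t.succ h = t := by
  ext
  simp [prevCrossing]

open Classical in
/-- Orient the strand positions alternately up and down, the position `j` upwards if `j + e` is
even; every resolution respects these orientations.  This is the successor of a point along the
oriented circle through it. -/
def nextPoint (e : ℕ) (I : Resolution w) (x : Point w) : Point w :=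
  if (x.2.val + e) % 2 = 0 then
    if h : x.1.val < w.length then
      if x.2 = leftPos ⟨x.1.val, h⟩ ∧ ¬ I.Braidlike ⟨x.1.val, h⟩ then (x.1, rightPos ⟨x.1.val, h⟩)
      else if x.2 = rightPos ⟨x.1.val, h⟩ ∧ ¬ I.Braidlike ⟨x.1.val, h⟩ then
        (x.1, leftPos ⟨x.1.val, h⟩)
      else (⟨x.1.val + 1, by omega⟩, x.2)
    else (0, x.2)
  else
    if h : 0 < x.1.val then
      if x.2 = leftPos (prevCrossing x.1 h) ∧ ¬ I.Braidlike (prevCrossing x.1 h) then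
        (x.1, rightPos (prevCrossing x.1 h))
      else if x.2 = rightPos (prevCrossing x.1 h) ∧ ¬ I.Braidlike (prevCrossing x.1 h) then
        (x.1, leftPos (prevCrossing x.1 h))
      else ((prevCrossing x.1 h).castSucc, x.2)
    else (Fin.last _, x.2)

section NextPoint

variable (e : ℕ) (I : Resolution w)

theorem nextPoint_up_left (t : Crossing w) (h : ¬ I.Braidlike t)
    (he : ((leftPos t).val + e) % 2 = 0) :
    nextPoint e I (t.castSucc, leftPos t) = (t.castSucc, rightPos t) := by
  simp [nextPoint, he, h]

theorem nextPoint_up_right (t : Crossing w) (h : ¬ I.Braidlike t)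
    (he : ((rightPos t).val + e) % 2 = 0) :
    nextPoint e I (t.castSucc, rightPos t) = (t.castSucc, leftPos t) := by
  simp [nextPoint, he, h, rightPos_ne_leftPos]

theorem nextPoint_up (t : Crossing w) (j : Fin n)
    (h : I.Braidlike t ∨ (j ≠ leftPos t ∧ j ≠ rightPos t)) (he : (j.val + e) % 2 = 0) :
    nextPoint e I (t.castSucc, j) = (t.succ, j) := by
  rcases h with h | h <;> simp [nextPoint, he, h] <;> rfl

theorem nextPoint_last (j : Fin n) (he : (j.val + e) % 2 = 0) :
    nextPoint e I (Fin.last _, j) = (0, j) := by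
  simp [nextPoint, he]

theorem nextPoint_down_left (t : Crossing w) (h : ¬ I.Braidlike t)
    (he : ((leftPos t).val + e) % 2 ≠ 0) :
    nextPoint e I (t.succ, leftPos t) = (t.succ, rightPos t) := by
  simp [nextPoint, he, h, prevCrossing_succ]

theorem nextPoint_down_right (t : Crossing w) (h : ¬ I.Braidlike t)
    (he : ((rightPos t).val + e) % 2 ≠ 0) :
    nextPoint e I (t.succ, rightPos t) = (t.succ, leftPos t) := by
  simp [nextPoint, he, h, rightPos_ne_leftPos, prevCrossing_succ]

theorem nextPoint_down (t : Crossing w) (j : Fin n)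
    (h : I.Braidlike t ∨ (j ≠ leftPos t ∧ j ≠ rightPos t)) (he : (j.val + e) % 2 ≠ 0) :
    nextPoint e I (t.succ, j) = (t.castSucc, j) := by
  rcases h with h | h <;> simp [nextPoint, he, h, prevCrossing_succ]

theorem nextPoint_zero (j : Fin n) (he : (j.val + e) % 2 ≠ 0) :
    nextPoint e I (0, j) = (Fin.last _, j) := by
  simp [nextPoint, he]

/-- Every point is of one of the following kinds. -/
theorem nextPoint_cases {P : Point w → Prop}
    (up_left : ∀ t, ¬ I.Braidlike t → ((leftPos t).val + e) % 2 = 0 → P (t.castSucc, leftPos t))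
    (up_right : ∀ t, ¬ I.Braidlike t → ((rightPos t).val + e) % 2 = 0 → P (t.castSucc, rightPos t))
    (up : ∀ t (j : Fin n), (I.Braidlike t ∨ (j ≠ leftPos t ∧ j ≠ rightPos t)) →
      (j.val + e) % 2 = 0 → P (t.castSucc, j))
    (last : ∀ j : Fin n, (j.val + e) % 2 = 0 → P (Fin.last _, j))
    (down_left : ∀ t, ¬ I.Braidlike t → ((leftPos t).val + e) % 2 ≠ 0 → P (t.succ, leftPos t))
    (down_right : ∀ t, ¬ I.Braidlike t → ((rightPos t).val + e) % 2 ≠ 0 → P (t.succ, rightPos t))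
    (down : ∀ t (j : Fin n), (I.Braidlike t ∨ (j ≠ leftPos t ∧ j ≠ rightPos t)) →
      (j.val + e) % 2 ≠ 0 → P (t.succ, j))
    (zero : ∀ j : Fin n, (j.val + e) % 2 ≠ 0 → P (0, j)) (x : Point w) : P x := by
  obtain ⟨s, j⟩ := x
  by_cases he : (j.val + e) % 2 = 0
  · induction s using Fin.lastCases with
    | last => exact last j he
    | cast t =>
      by_cases hb : I.Braidlike t
      · exact up t j (Or.inl hb) he
      by_cases hl : j = leftPos t
      · subst hl; exact up_left t hb he
      by_cases hr : j = rightPos t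
      · subst hr; exact up_right t hb he
      exact up t j (Or.inr ⟨hl, hr⟩) he
  · induction s using Fin.cases with
    | zero => exact zero j he
    | succ t =>
      by_cases hb : I.Braidlike t
      · exact down t j (Or.inl hb) he
      by_cases hl : j = leftPos t
      · subst hl; exact down_left t hb he
      by_cases hr : j = rightPos t
      · subst hr; exact down_right t hb he
      exact down t j (Or.inr ⟨hl, hr⟩) he

/-- Raising `e` by one reverses the orientation of every circle, so the successor for `e + 1` is the
predecessor for `e`. This makes the successor map a bijection. -/
theorem nextPoint_nextPoint (x : Point w) : nextPoint (e + 1) I (nextPoint e I x) = x := by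
  induction x using nextPoint_cases e I with
  | up_left t h he =>
    rw [nextPoint_up_left e I t h he, nextPoint_up_right _ I t h (by rw [rightPos_val]; omega)]
  | up_right t h he =>
    rw [nextPoint_up_right e I t h he, nextPoint_up_left _ I t h (by rw [rightPos_val] at he; omega)]
  | up t j h he => rw [nextPoint_up e I t j h he, nextPoint_down _ I t j h (by omega)]
  | last j he => rw [nextPoint_last e I j he, nextPoint_zero _ I j (by omega)]
  | down_left t h he =>
    rw [nextPoint_down_left e I t h he, nextPoint_down_right _ I t h (by rw [rightPos_val]; omega)]
  | down_right t h he =>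
    rw [nextPoint_down_right e I t h he,
      nextPoint_down_left _ I t h (by rw [rightPos_val] at he; omega)]
  | down t j h he => rw [nextPoint_down e I t j h he, nextPoint_up _ I t j h (by omega)]
  | zero j he => rw [nextPoint_zero e I j he, nextPoint_last _ I j (by omega)]

/-- The permutation of the points whose cycles are the circles of the resolution `I`. -/
def circlePerm : Equiv.Perm (Point w) :=
  Equiv.ofBijective (nextPoint e I)
    ((Function.LeftInverse.injective (nextPoint_nextPoint e I)).bijective_of_finite)

theorem circlePerm_apply (x : Point w) : circlePerm e I x = nextPoint e I x := rfl

end NextPoint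

namespace SameCircle

variable {I : Resolution w} {x y z : Point w}

theorem refl (I : Resolution w) (x : Point w) : SameCircle I x x := Relation.EqvGen.refl x

theorem symm (h : SameCircle I x y) : SameCircle I y x := Relation.EqvGen.symm _ _ h

theorem trans (h : SameCircle I x y) (h' : SameCircle I y z) : SameCircle I x z :=
  Relation.EqvGen.trans _ _ _ h h'

theorem comm : SameCircle I x y ↔ SameCircle I y x := ⟨symm, symm⟩

theorem of_arc (h : Arc I x y) : SameCircle I x y := Relation.EqvGen.rel _ _ h

/-- Induction over the arcs: an equivalence relation that holds along arcs holds along circles. -/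
theorem le_of_arc {R : Point w → Point w → Prop} (hR : Equivalence R)
    (h : ∀ x y, Arc I x y → R x y) (hxy : SameCircle I x y) : R x y := by
  induction hxy with
  | rel x y hx => exact h x y hx
  | refl x => exact hR.refl x
  | symm x y _ ih => exact hR.symm ih
  | trans x y z _ _ ih₁ ih₂ => exact hR.trans ih₁ ih₂

theorem label_eq (S : Generator w) (h : SameCircle S.res x y) : S.label x = S.label y :=
  le_of_arc (R := fun x y => S.label x = S.label y)
    ⟨fun _ => rfl, fun h => h.symm, fun h h' => h.trans h'⟩ S.label_arc h

end SameCircle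

/-- Each step of the permutation runs along an arc, and each arc is run through by a step in one of
its two directions. -/
theorem sameCycle_circlePerm_iff (e : ℕ) (I : Resolution w) (x y : Point w) :
    (circlePerm e I).SameCycle x y ↔ SameCircle I x y := by
  have hstep : ∀ x, SameCircle I x (circlePerm e I x) := by
    intro x
    rw [circlePerm_apply]
    induction x using nextPoint_cases e I with
    | up_left t h he =>
      rw [nextPoint_up_left e I t h he]; exact .of_arc (.turn_bottom t h)
    | up_right t h he =>
      rw [nextPoint_up_right e I t h he]; exact (SameCircle.of_arc (.turn_bottom t h)).symm
    | up t j h he =>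
      rw [nextPoint_up e I t j h he]
      by_cases hl : j = leftPos t
      · subst hl; exact .of_arc (.through_left t (by tauto))
      by_cases hr : j = rightPos t
      · subst hr; exact .of_arc (.through_right t (by tauto))
      exact .of_arc (.strand t j hl hr)
    | last j he => rw [nextPoint_last e I j he]; exact .of_arc (.closing j)
    | down_left t h he =>
      rw [nextPoint_down_left e I t h he]; exact .of_arc (.turn_top t h)
    | down_right t h he =>
      rw [nextPoint_down_right e I t h he]; exact (SameCircle.of_arc (.turn_top t h)).symm
    | down t j h he =>
      rw [nextPoint_down e I t j h he]
      refine SameCircle.symm ?_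
      by_cases hl : j = leftPos t
      · subst hl; exact .of_arc (.through_left t (by tauto))
      by_cases hr : j = rightPos t
      · subst hr; exact .of_arc (.through_right t (by tauto))
      exact .of_arc (.strand t j hl hr)
    | zero j he => rw [nextPoint_zero e I j he]; exact (SameCircle.of_arc (.closing j)).symm
  constructor
  · intro h
    obtain ⟨m, rfl⟩ := h.exists_nat_pow_eq
    clear h
    induction m with
    | zero => exact .refl I x
    | succ m ih => rw [pow_succ', Equiv.Perm.mul_apply]; exact ih.trans (hstep _)
  · refine SameCircle.le_of_arc (Equiv.Perm.SameCycle.equivalence _) ?_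
    have of_eq : ∀ {x y : Point w}, nextPoint e I x = y → (circlePerm e I).SameCycle x y :=
      fun h => ⟨1, by simpa [circlePerm_apply] using h⟩
    have vert : ∀ (t : Crossing w) (j : Fin n),
        (I.Braidlike t ∨ (j ≠ leftPos t ∧ j ≠ rightPos t)) →
        (circlePerm e I).SameCycle (t.castSucc, j) (t.succ, j) := by
      intro t j h
      by_cases he : (j.val + e) % 2 = 0
      · exact of_eq (nextPoint_up e I t j h he)
      · exact (of_eq (nextPoint_down e I t j h he)).symm
    intro x y h
    cases h with
    | strand t j hl hr => exact vert t j (Or.inr ⟨hl, hr⟩)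
    | through_left t h => exact vert t _ (Or.inl h)
    | through_right t h => exact vert t _ (Or.inl h)
    | turn_bottom t h =>
      by_cases he : ((leftPos t).val + e) % 2 = 0
      · exact of_eq (nextPoint_up_left e I t h he)
      · exact (of_eq (nextPoint_up_right e I t h (by rw [rightPos_val]; omega))).symm
    | turn_top t h =>
      by_cases he : ((leftPos t).val + e) % 2 = 0
      · exact (of_eq (nextPoint_down_right e I t h (by rw [rightPos_val]; omega))).symm
      · exact of_eq (nextPoint_down_left e I t h he)
    | closing j =>
      by_cases he : (j.val + e) % 2 = 0
      · exact of_eq (nextPoint_last e I j he)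
      · exact (of_eq (nextPoint_zero e I j he)).symm

/-- The lower left corner of a crossing. -/
def cornerL (t : Crossing w) : Point w := (t.castSucc, leftPos t)

/-- The upper right corner of a crossing. -/
def cornerR (t : Crossing w) : Point w := (t.succ, rightPos t)

theorem cornerL_ne_cornerR (t : Crossing w) : cornerL t ≠ cornerR t := fun h =>
  rightPos_ne_leftPos t (congrArg Prod.snd h).symm

/-- The point lies on one of the circles through the crossing `t`. -/
def Near (I : Resolution w) (t : Crossing w) (x : Point w) : Prop :=
  SameCircle I x (cornerL t) ∨ SameCircle I x (cornerR t)

theorem Near.congr {I : Resolution w} {t : Crossing w} {x y : Point w} (h : SameCircle I x y) :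
    Near I t x ↔ Near I t y :=
  ⟨fun h' => h'.imp h.symm.trans h.symm.trans, fun h' => h'.imp h.trans h.trans⟩

/-- The resolutions `I` and `I'` differ exactly at the crossing `t`. -/
def DifferAt (t : Crossing w) (I I' : Resolution w) : Prop :=
  (∀ s, s ≠ t → I s = I' s) ∧ I t ≠ I' t

namespace DifferAt

variable {t : Crossing w} {I I' : Resolution w}

theorem symm (h : DifferAt t I I') : DifferAt t I' I :=
  ⟨fun s hs => (h.1 s hs).symm, h.2.symm⟩

theorem braidlike_iff_of_ne (h : DifferAt t I I') {s : Crossing w} (hs : s ≠ t) :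
    I.Braidlike s ↔ I'.Braidlike s := by
  unfold Resolution.Braidlike
  rw [h.1 s hs]

theorem braidlike_iff_not (h : DifferAt t I I') : I.Braidlike t ↔ ¬ I'.Braidlike t := by
  have := h.2
  unfold Resolution.Braidlike
  generalize I t = a at *
  generalize I' t = b at *
  generalize (w.get t).2 = c at *
  revert a b c
  decide

theorem near_corner (I : Resolution w) (t : Crossing w) :
    (Near I t (t.castSucc, leftPos t) ∧ Near I t (t.castSucc, rightPos t)) ∧
      (Near I t (t.succ, leftPos t) ∧ Near I t (t.succ, rightPos t)) := by
  have hL : Near I t (t.castSucc, leftPos t) := Or.inl (.refl _ _)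
  have hR : Near I t (t.succ, rightPos t) := Or.inr (.refl _ _)
  by_cases h : I.Braidlike t
  · exact ⟨⟨hL, (Near.congr (.of_arc (.through_right t h))).2 hR⟩,
      (Near.congr (.of_arc (.through_left t h))).1 hL, hR⟩
  · exact ⟨⟨hL, (Near.congr (.of_arc (.turn_bottom t h))).1 hL⟩,
      (Near.congr (.of_arc (.turn_top t h))).2 hR, hR⟩

/-- The only arcs that change join corners of `t`, and all four corners are near `t` in either
resolution. The right-hand side is an equivalence relation, so it suffices to check it on arcs. -/
theorem sameCircle_or_near (h : DifferAt t I I') {x y : Point w} (hxy : SameCircle I x y) :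
    SameCircle I' x y ∨ (Near I' t x ∧ Near I' t y) := by
  have heq : Equivalence fun x y => SameCircle I' x y ∨ (Near I' t x ∧ Near I' t y) := by
    refine ⟨fun x => Or.inl (.refl _ _), ?_, ?_⟩
    · rintro x y (h | h)
      · exact Or.inl h.symm
      · exact Or.inr h.symm
    · rintro x y z (h | h) (h' | h')
      · exact Or.inl (h.trans h')
      · exact Or.inr ⟨(Near.congr h).2 h'.1, h'.2⟩
      · exact Or.inr ⟨h.1, (Near.congr h').1 h.2⟩
      · exact Or.inr ⟨h.1, h'.2⟩
  refine SameCircle.le_of_arc heq ?_ hxy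
  have hc := near_corner I' t
  intro x y ha
  cases ha with
  | strand s j hl hr => exact Or.inl (.of_arc (.strand s j hl hr))
  | through_left s hs =>
    by_cases hst : s = t
    · subst hst; tauto
    · exact Or.inl (.of_arc (.through_left s ((h.braidlike_iff_of_ne hst).1 hs)))
  | through_right s hs =>
    by_cases hst : s = t
    · subst hst; tauto
    · exact Or.inl (.of_arc (.through_right s ((h.braidlike_iff_of_ne hst).1 hs)))
  | turn_bottom s hs =>
    by_cases hst : s = t
    · subst hst; tauto
    · exact Or.inl (.of_arc (.turn_bottom s (mt (h.braidlike_iff_of_ne hst).2 hs)))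
  | turn_top s hs =>
    by_cases hst : s = t
    · subst hst; tauto
    · exact Or.inl (.of_arc (.turn_top s (mt (h.braidlike_iff_of_ne hst).2 hs)))
  | closing j => exact Or.inl (.of_arc (.closing j))

theorem near_iff (h : DifferAt t I I') {x : Point w} : Near I t x ↔ Near I' t x := by
  have key : ∀ {I I' : Resolution w}, DifferAt t I I' → Near I t x → Near I' t x := by
    rintro I I' h (hx | hx)
    · rcases h.sameCircle_or_near hx with hx | hx
      · exact Or.inl hx
      · exact hx.1
    · rcases h.sameCircle_or_near hx with hx | hx
      · exact Or.inr hx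
      · exact hx.1
  exact ⟨key h, key h.symm⟩

/-- Away from the crossing the circles do not change. -/
theorem sameCircle_iff_of_not_near (h : DifferAt t I I') {x y : Point w} (hx : ¬ Near I t x) :
    SameCircle I x y ↔ SameCircle I' x y := by
  constructor
  · intro hxy
    rcases h.sameCircle_or_near hxy with h' | h'
    · exact h'
    · exact absurd (h.near_iff.2 h'.1) hx
  · intro hxy
    rcases h.symm.sameCircle_or_near hxy with h' | h'
    · exact h'
    · exact absurd h'.1 hx

/-- If the crossing meets only one circle of `I'`, then `I'` is coarser than `I`. -/
theorem sameCircle_mono (h : DifferAt t I I') (hI' : SameCircle I' (cornerL t) (cornerR t))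
    {x y : Point w} (hxy : SameCircle I x y) : SameCircle I' x y := by
  rcases h.sameCircle_or_near hxy with h' | ⟨hx, hy⟩
  · exact h'
  · have : ∀ z, Near I' t z → SameCircle I' z (cornerL t) := by
      rintro z (hz | hz)
      · exact hz
      · exact hz.trans hI'.symm
    exact (this x hx).trans (this y hy).symm

/-- Changing the resolution of a crossing either merges two circles or splits one. -/
theorem sameCircle_corner_iff (h : DifferAt t I I') :
    SameCircle I (cornerL t) (cornerR t) ↔ ¬ SameCircle I' (cornerL t) (cornerR t) := by
  classical
  have key : ∀ {I I' : Resolution w}, DifferAt t I I' → I'.Braidlike t →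
      (SameCircle I (cornerL t) (cornerR t) ↔ ¬ SameCircle I' (cornerL t) (cornerR t)) := by
    intro I I' h hb'
    have hb : ¬ I.Braidlike t := fun hb => (h.braidlike_iff_not.1 hb) hb'
    -- With this parity the left strand runs upwards and the right one downwards at `t`, so `cornerL
    -- t` and `cornerR t` are the two points from which the orientation enters the crossing. The two
    -- smoothings exchange their successors.
    set e := (leftPos t).val with he
    have heq : circlePerm e I = circlePerm e I' * Equiv.swap (cornerL t) (cornerR t) := by
      ext1 x
      have h0 : ((leftPos t).val + e) % 2 = 0 := by omega
      have h1 : ((rightPos t).val + e) % 2 ≠ 0 := by rw [rightPos_val]; omega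
      rw [Equiv.Perm.mul_apply]
      by_cases hL : x = cornerL t
      · subst hL
        rw [Equiv.swap_apply_left, circlePerm_apply, circlePerm_apply, cornerL, cornerR,
          nextPoint_up_left e I t hb h0, nextPoint_down e I' t _ (Or.inl hb') h1]
      by_cases hR : x = cornerR t
      · subst hR
        rw [Equiv.swap_apply_right, circlePerm_apply, circlePerm_apply, cornerL, cornerR,
          nextPoint_down_right e I t hb h1, nextPoint_up e I' t _ (Or.inl hb') h0]
      rw [Equiv.swap_apply_of_ne_of_ne hL hR, circlePerm_apply, circlePerm_apply]
      induction x using nextPoint_cases e I with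
      | up_left s hs hse =>
        have hst : s ≠ t := by rintro rfl; exact hL rfl
        rw [nextPoint_up_left e I s hs hse,
          nextPoint_up_left e I' s (mt (h.braidlike_iff_of_ne hst).2 hs) hse]
      | up_right s hs hse =>
        have hst : s ≠ t := by rintro rfl; exact h1 hse
        rw [nextPoint_up_right e I s hs hse,
          nextPoint_up_right e I' s (mt (h.braidlike_iff_of_ne hst).2 hs) hse]
      | up s j hs hse =>
        rw [nextPoint_up e I s j hs hse, nextPoint_up e I' s j ?_ hse]
        by_cases hst : s = t
        · subst hst; tauto
        · exact hs.imp_left (h.braidlike_iff_of_ne hst).1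
      | last j hse => rw [nextPoint_last e I j hse, nextPoint_last e I' j hse]
      | down_left s hs hse =>
        have hst : s ≠ t := by rintro rfl; exact hse h0
        rw [nextPoint_down_left e I s hs hse,
          nextPoint_down_left e I' s (mt (h.braidlike_iff_of_ne hst).2 hs) hse]
      | down_right s hs hse =>
        have hst : s ≠ t := by rintro rfl; exact hR rfl
        rw [nextPoint_down_right e I s hs hse,
          nextPoint_down_right e I' s (mt (h.braidlike_iff_of_ne hst).2 hs) hse]
      | down s j hs hse =>
        rw [nextPoint_down e I s j hs hse, nextPoint_down e I' s j ?_ hse]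
        by_cases hst : s = t
        · subst hst; tauto
        · exact hs.imp_left (h.braidlike_iff_of_ne hst).1
      | zero j hse => rw [nextPoint_zero e I j hse, nextPoint_zero e I' j hse]
    rw [← sameCycle_circlePerm_iff e I, ← sameCycle_circlePerm_iff e I', heq]
    exact sameCycle_mul_swap_iff _ (cornerL_ne_cornerR t)
  by_cases hb : I'.Braidlike t
  · exact key h hb
  · have := key h.symm (h.braidlike_iff_not.2 hb)
    tauto

end DifferAt

end Edge

/-! ### Chains as functions on sets of points, and the faces of the cube. -/

section DiffSq

variable {n : ℕ} {w : BraidWord n}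

theorem mergeRule_iff (x y z : Bool) : MergeRule x y z ↔ z = (x && y) ∧ (x || y) = true := by
  cases x <;> cases y <;> cases z <;> simp [MergeRule]

theorem splitRule_iff (x y z : Bool) : SplitRule z x y ↔ z = (x || y) ∧ (x && y) = false := by
  cases x <;> cases y <;> cases z <;> simp [SplitRule]

theorem differAt_update {I : Resolution w} {t : Crossing w} {b : Bool} (h : I t = !b) :
    DifferAt t (Function.update I t b) I :=
  ⟨fun s hs => by simp [hs], by simp [h]⟩

theorem update_eq_comm {J I : Resolution w} {t : Crossing w} (b : Bool) :
    (J t = b ∧ I = Function.update J t (!b)) ↔ (I t = (!b) ∧ J = Function.update I t b) := by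
  constructor
  · rintro ⟨h, rfl⟩
    simp [← h]
  · rintro ⟨h, rfl⟩
    simp [← h]

namespace IncidentAt

variable {t : Crossing w} {S T : Generator w}

theorem differAt (h : IncidentAt t S T) : DifferAt t S.res T.res := by
  have := (update_eq_comm false).1 ⟨h.1, h.2.1⟩
  rw [this.2]
  exact differAt_update this.1

theorem merge_iff (h : ¬ SameCircle S.res (cornerL t) (cornerR t)) :
    IncidentAt t S T ↔ (S.res t = false ∧ T.res = Function.update S.res t true) ∧
      (∀ x, ¬ Near S.res t x → T.label x = S.label x) ∧
      T.label (cornerL t) = (S.label (cornerL t) && S.label (cornerR t)) ∧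
      (S.label (cornerL t) || S.label (cornerR t)) = true := by
  unfold Near
  rw [← mergeRule_iff]
  simp only [IncidentAt]
  change _ ∧ _ ∧ _ ∧ (¬ SameCircle S.res (cornerL t) (cornerR t) → _) ∧
    (SameCircle S.res (cornerL t) (cornerR t) → _) ↔ _
  simp only [h, not_false_eq_true, true_imp_iff, false_imp_iff, and_true, not_or, and_imp,
    and_assoc]
  rfl

theorem split_iff (h : SameCircle S.res (cornerL t) (cornerR t)) :
    IncidentAt t S T ↔ (S.res t = false ∧ T.res = Function.update S.res t true) ∧
      (∀ x, ¬ Near S.res t x → T.label x = S.label x) ∧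
      S.label (cornerL t) = (T.label (cornerL t) || T.label (cornerR t)) ∧
      (T.label (cornerL t) && T.label (cornerR t)) = false := by
  unfold Near
  rw [← splitRule_iff]
  simp only [IncidentAt]
  change _ ∧ _ ∧ _ ∧ (¬ SameCircle S.res (cornerL t) (cornerR t) → _) ∧
    (SameCircle S.res (cornerL t) (cornerR t) → _) ↔ _
  simp only [h, not_true_eq_false, true_imp_iff, false_imp_iff, true_and, not_or, and_imp,
    and_assoc]
  rfl

end IncidentAt

/-- A generator is determined by its resolution and its labels away from a crossing and at two
opposite corners of this crossing. -/
theorem Generator.ext_of_near {S T : Generator w} (t : Crossing w) (hres : S.res = T.res)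
    (h : ∀ x, ¬ Near S.res t x → S.label x = T.label x)
    (hL : S.label (cornerL t) = T.label (cornerL t))
    (hR : S.label (cornerR t) = T.label (cornerR t)) : S = T := by
  refine Generator.ext hres (funext fun x => ?_)
  by_cases hx : Near S.res t x
  · rcases hx with hx | hx
    · rw [SameCircle.label_eq S hx, hL]
      rw [hres] at hx
      exact (SameCircle.label_eq T hx).symm
    · rw [SameCircle.label_eq S hx, hR]
      rw [hres] at hx
      exact (SameCircle.label_eq T hx).symm
  · exact h x hx

-- The resolutions of two incident generators differ at exactly one crossing, so the sets of
-- predecessors along different crossings are disjoint.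
open Classical in
theorem diff_apply (x : CKh w) (T : Generator w) :
    diff w x T = ∑ t, ∑ S : Generator w with IncidentAt t S T, x S := by
  rw [← Finset.sum_biUnion]
  · change (∑ S : Generator w with ∃ t, IncidentAt t S T, x S) = _
    congr 1
    ext S
    simp
  · intro t _ s _ hts
    refine Finset.disjoint_left.2 fun S hS hS' => hts ?_
    simp only [Finset.mem_filter, Finset.mem_univ, true_and] at hS hS'
    by_contra hne
    exact hS.differAt.2 (hS'.differAt.1 t hne)

open Classical in
/-- The generator with resolution `I` whose circles labelled `v₊` are those which meet `σ`. -/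
def gen (I : Resolution w) (σ : Finset (Point w)) : Generator w where
  res := I
  label := fun x => decide (∃ a ∈ σ, SameCircle I x a)
  label_arc := fun x y h => by
    have hxy : SameCircle I x y := .of_arc h
    congr 1
    exact propext ⟨fun ⟨a, ha, h⟩ => ⟨a, ha, hxy.symm.trans h⟩, fun ⟨a, ha, h⟩ => ⟨a, ha, hxy.trans h⟩⟩

theorem gen_label_iff (I : Resolution w) (σ : Finset (Point w)) (x : Point w) :
    (gen I σ).label x = true ↔ ∃ a ∈ σ, SameCircle I x a := by
  simp [gen]

/-- The set `σ` has at most one point on each circle of `I`. -/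
def Indep (I : Resolution w) (σ : Finset (Point w)) : Prop :=
  ∀ a ∈ σ, ∀ b ∈ σ, SameCircle I a b → a = b

open Classical in
theorem Generator.exists_gen_eq (S : Generator w) : ∃ σ, Indep S.res σ ∧ gen S.res σ = S := by
  let out : Point w → Point w := fun a => (⟦a⟧ : Circle S.res).out
  have hout : ∀ a, SameCircle S.res (out a) a := fun a => Quotient.mk_out (s := circleSetoid S.res) a
  have hout' : ∀ a b, SameCircle S.res a b → out a = out b := fun a b h =>
    congrArg Quotient.out (Quotient.sound (s := circleSetoid S.res) h)
  refine ⟨Finset.univ.filter fun a => out a = a ∧ S.label a = true, ?_, ?_⟩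
  · intro a ha b hb hab
    simp only [Finset.mem_filter, Finset.mem_univ, true_and] at ha hb
    rw [← ha.1, ← hb.1, hout' a b hab]
  · refine Generator.ext rfl (funext fun x => ?_)
    rw [Bool.eq_iff_iff, gen_label_iff]
    simp only [Finset.mem_filter, Finset.mem_univ, true_and]
    constructor
    · rintro ⟨a, ⟨_, ha⟩, hxa⟩
      rw [SameCircle.label_eq S hxa, ha]
    · intro hx
      refine ⟨out x, ⟨hout' _ _ (hout x), ?_⟩, (hout x).symm⟩
      rw [SameCircle.label_eq S (hout x), hx]

open Classical in
/-- The coefficients of a chain in the resolution `I`, as a function of sets of points: a set with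
at most one point on each circle stands for the generator in which the circles that it meets are
labelled `v₊`. -/
def ev (I : Resolution w) (x : CKh w) (σ : Finset (Point w)) : ZMod 2 :=
  if Indep I σ then x (gen I σ) else 0

/-- The operator on functions of sets of points that corresponds to multiplication by `v₋` on the
circle through the point `p`. -/
def mulAt (p : Point w) : (Finset (Point w) → ZMod 2) →ₗ[ZMod 2] (Finset (Point w) → ZMod 2) where
  toFun g σ := if p ∈ σ then 0 else g (insert p σ)
  map_add' g g' := by funext σ; by_cases h : p ∈ σ <;> simp [h]
  map_smul' c g := by funext σ; by_cases h : p ∈ σ <;> simp [h]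

theorem mulAt_apply (p : Point w) (g : Finset (Point w) → ZMod 2) (σ : Finset (Point w)) :
    mulAt p g σ = if p ∈ σ then 0 else g (insert p σ) := rfl

theorem mulAt_comm (p q : Point w) (g : Finset (Point w) → ZMod 2) :
    mulAt p (mulAt q g) = mulAt q (mulAt p g) := by
  funext σ
  simp only [mulAt_apply, Finset.mem_insert]
  by_cases hpq : p = q
  · subst hpq; rfl
  · by_cases hp : p ∈ σ <;> by_cases hq : q ∈ σ <;> simp [hp, hq, hpq, Ne.symm hpq, Finset.insert_comm]

/-- Coefficients vanish on sets with two points on one circle, and otherwise depend only on the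
circles that are met; hence it does not matter which point of a circle is inserted. -/
theorem mulAt_ev_congr {I : Resolution w} {a b : Point w} (h : SameCircle I a b) (x : CKh w) :
    mulAt a (ev I x) = mulAt b (ev I x) := by
  by_cases hab : a = b
  · rw [hab]
  have aux : ∀ {a b : Point w}, SameCircle I a b → a ≠ b → ∀ σ, b ∈ σ →
      mulAt a (ev I x) σ = 0 := by
    intro a b h hab σ hb
    rw [mulAt_apply]
    split_ifs with ha
    · rfl
    · refine if_neg fun hi => hab ?_
      exact hi a (Finset.mem_insert_self _ _) b (Finset.mem_insert_of_mem hb) h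
  funext σ
  by_cases hb : b ∈ σ
  · rw [aux h hab σ hb, mulAt_apply, if_pos hb]
  by_cases ha : a ∈ σ
  · rw [aux h.symm (Ne.symm hab) σ ha, mulAt_apply, if_pos ha]
  rw [mulAt_apply, mulAt_apply, if_neg ha, if_neg hb]
  have hind : ∀ {a b : Point w}, SameCircle I a b → a ∉ σ → b ∉ σ → Indep I (insert a σ) →
      Indep I (insert b σ) := by
    intro a b h ha hb hi c hc d hd hcd
    have key : ∀ e ∈ σ, ¬ SameCircle I b e := fun e he hbe => by
      have := hi a (Finset.mem_insert_self _ _) e (Finset.mem_insert_of_mem he) (h.trans hbe)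
      exact ha (this ▸ he)
    rcases Finset.mem_insert.1 hc with hc' | hc' <;> rcases Finset.mem_insert.1 hd with hd' | hd'
    · rw [hc', hd']
    · exact absurd (hc' ▸ hcd) (key d hd')
    · exact absurd (hd' ▸ hcd.symm) (key c hc')
    · exact hi c (Finset.mem_insert_of_mem hc') d (Finset.mem_insert_of_mem hd') hcd
  have hgen : gen I (insert a σ) = gen I (insert b σ) := by
    refine Generator.ext rfl (funext fun y => ?_)
    rw [Bool.eq_iff_iff, gen_label_iff, gen_label_iff]
    simp only [Finset.mem_insert, exists_eq_or_imp]
    rw [show SameCircle I y a ↔ SameCircle I y b from ⟨fun h' => h'.trans h, fun h' => h'.trans h.symm⟩]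
  unfold ev
  rw [hgen]
  by_cases hi : Indep I (insert a σ)
  · rw [if_pos hi, if_pos (hind h ha hb hi)]
  · rw [if_neg hi, if_neg (mt (hind h.symm hb ha) hi)]

open Classical in
/-- The part of the differential that belongs to the crossing `t`, which is `0`-resolved in `J`. -/
def edgeOp (J : Resolution w) (t : Crossing w) :
    (Finset (Point w) → ZMod 2) →ₗ[ZMod 2] (Finset (Point w) → ZMod 2) :=
  if SameCircle J (cornerL t) (cornerR t) then LinearMap.id else mulAt (cornerL t) + mulAt (cornerR t)

theorem edgeOp_of_same {J : Resolution w} {t : Crossing w}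
    (h : SameCircle J (cornerL t) (cornerR t)) (g : Finset (Point w) → ZMod 2) :
    edgeOp J t g = g := by
  simp [edgeOp, h]

theorem edgeOp_of_not_same {J : Resolution w} {t : Crossing w}
    (h : ¬ SameCircle J (cornerL t) (cornerR t)) (g : Finset (Point w) → ZMod 2) :
    edgeOp J t g = mulAt (cornerL t) g + mulAt (cornerR t) g := by
  simp [edgeOp, h]

theorem add_self_eq_zero_of_fun {α : Type*} (g : α → ZMod 2) : g + g = 0 := by
  funext a
  exact CharTwo.add_self_eq_zero _

/-- The two ways around a face of the cube of resolutions agree. -/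
theorem edgeOp_edgeOp_comm {K Js Jt I : Resolution w} {s t : Crossing w} (hKs : DifferAt s K Js)
    (hKt : DifferAt t K Jt) (hsI : DifferAt t Js I) (htI : DifferAt s Jt I) (x : CKh w) :
    edgeOp Js t (edgeOp K s (ev K x)) = edgeOp Jt s (edgeOp K t (ev K x)) := by
  set g := ev K x with hg
  have hcomm : (mulAt (cornerL t) + mulAt (cornerR t)) ((mulAt (cornerL s) + mulAt (cornerR s)) g) =
      (mulAt (cornerL s) + mulAt (cornerR s)) ((mulAt (cornerL t) + mulAt (cornerR t)) g) := by
    simp only [LinearMap.add_apply, map_add]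
    rw [mulAt_comm (cornerL t) (cornerL s), mulAt_comm (cornerL t) (cornerR s),
      mulAt_comm (cornerR t) (cornerL s), mulAt_comm (cornerR t) (cornerR s)]
    abel
  have hzero : ∀ r : Crossing w, SameCircle K (cornerL r) (cornerR r) →
      mulAt (cornerL r) g + mulAt (cornerR r) g = 0 := by
    intro r hr
    rw [hg, mulAt_ev_congr hr, add_self_eq_zero_of_fun]
  have split_of_split : ∀ {s t : Crossing w} {Js : Resolution w}, DifferAt s K Js →
      SameCircle K (cornerL s) (cornerR s) → ¬ SameCircle K (cornerL t) (cornerR t) →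
      ¬ SameCircle Js (cornerL t) (cornerR t) :=
    fun h hs ht h' => ht (h.symm.sameCircle_mono hs h')
  have same_of_merge : ∀ {s t : Crossing w} {Js : Resolution w}, DifferAt s K Js →
      ¬ SameCircle K (cornerL s) (cornerR s) → SameCircle K (cornerL t) (cornerR t) →
      SameCircle Js (cornerL t) (cornerR t) :=
    fun h hs ht => h.sameCircle_mono (h.symm.sameCircle_corner_iff.2 hs) ht
  by_cases hA : SameCircle K (cornerL t) (cornerR t) <;>
    by_cases hB : SameCircle K (cornerL s) (cornerR s)
  -- Both first edges split. The second edges are then of the same type on both sides: if both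
  -- split, both composites are the identity; if both merge, both composites vanish on `ev K x`,
  -- because the two corners involved lie on one circle of `K`.
  · have key : ∀ {s t : Crossing w} {Js Jt : Resolution w}, DifferAt s K Js → DifferAt t K Jt →
        DifferAt t Js I → DifferAt s Jt I → SameCircle K (cornerL t) (cornerR t) →
        SameCircle K (cornerL s) (cornerR s) → SameCircle Js (cornerL t) (cornerR t) →
        SameCircle Jt (cornerL s) (cornerR s) := by
      intro s t Js Jt hKs hKt hsI htI hA hB hAJ
      by_contra hBJ
      exact hKs.sameCircle_corner_iff.1 hB
        (hsI.symm.sameCircle_mono hAJ (htI.symm.sameCircle_corner_iff.2 hBJ))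
    rw [edgeOp_of_same hA, edgeOp_of_same hB]
    by_cases hAJ : SameCircle Js (cornerL t) (cornerR t)
    · rw [edgeOp_of_same hAJ, edgeOp_of_same (key hKs hKt hsI htI hA hB hAJ)]
    · rw [edgeOp_of_not_same hAJ, edgeOp_of_not_same (mt (key hKt hKs htI hsI hB hA) hAJ),
        hzero t hA, hzero s hB]
  -- One edge splits and the other merges. Each keeps its type after the other is applied, and the
  -- identity commutes with everything.
  · rw [edgeOp_of_same hA, edgeOp_of_same (same_of_merge hKs hB hA), edgeOp_of_not_same hB,
      edgeOp_of_not_same (split_of_split hKt hA hB)]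
  · rw [edgeOp_of_same hB, edgeOp_of_same (same_of_merge hKt hA hB), edgeOp_of_not_same hA,
      edgeOp_of_not_same (split_of_split hKs hB hA)]
  · rw [edgeOp_of_not_same hA, edgeOp_of_not_same hB]
    -- Both first edges merge. If `t` splits after the merge at `s`, then both crossings join the
    -- same two circles of `K`, so the two merge operators agree on `ev K x`. Otherwise all edges
    -- merge and the operators commute.
    have key : ∀ {s t : Crossing w} {Js Jt : Resolution w}, DifferAt s K Js → DifferAt t K Jt →
        ¬ SameCircle K (cornerL t) (cornerR t) → ¬ SameCircle K (cornerL s) (cornerR s) →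
        SameCircle Js (cornerL t) (cornerR t) → SameCircle Jt (cornerL s) (cornerR s) ∧
          mulAt (cornerL t) g + mulAt (cornerR t) g = mulAt (cornerL s) g + mulAt (cornerR s) g := by
      intro s t Js Jt hKs hKt hA hB hAJ
      have hJ : SameCircle Jt (cornerL t) (cornerR t) := hKt.symm.sameCircle_corner_iff.2 hA
      have up := fun {x y} => hKt.sameCircle_mono hJ (x := x) (y := y)
      rcases hKs.symm.sameCircle_or_near hAJ with h | ⟨hL, hR⟩
      · exact absurd h hA
      rcases hL with hL | hL <;> rcases hR with hR | hR
      · exact absurd (hL.trans hR.symm) hA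
      · refine ⟨(up hL.symm).trans (hJ.trans (up hR)), ?_⟩
        rw [hg, mulAt_ev_congr hL, mulAt_ev_congr hR]
      · refine ⟨(up hR.symm).trans (hJ.symm.trans (up hL)), ?_⟩
        rw [hg, mulAt_ev_congr hL, mulAt_ev_congr hR, add_comm]
      · exact absurd (hL.trans hR.symm) hA
    by_cases hAJ : SameCircle Js (cornerL t) (cornerR t)
    · obtain ⟨h1, h2⟩ := key hKs hKt hA hB hAJ
      rw [edgeOp_of_same hAJ, edgeOp_of_same h1, h2]
    · have hBJ : ¬ SameCircle Jt (cornerL s) (cornerR s) := fun h =>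
        hAJ (key hKt hKs hB hA h).1
      rw [edgeOp_of_not_same hAJ, edgeOp_of_not_same hBJ]
      exact hcomm

end DiffSq

/-! ### The differential in terms of edge operators, and d² = 0. -/

section DiffSq

variable {n : ℕ} {w : BraidWord n}

theorem IncidentAt.res_eq {t : Crossing w} {S T : Generator w} {J : Resolution w}
    (h : IncidentAt t S T) (hJ : J t = false) (hT : T.res = Function.update J t true) :
    S.res = J := by
  rw [((update_eq_comm false).1 ⟨h.1, h.2.1⟩).2, hT]
  simp [← hJ]

theorem gen_label_congr {J I : Resolution w} {t : Crossing w} (h : DifferAt t J I)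
    {σ τ : Finset (Point w)} (hστ : ∀ a, ¬ Near J t a → (a ∈ τ ↔ a ∈ σ)) (y : Point w)
    (hy : ¬ Near J t y) : (gen I σ).label y = (gen J τ).label y := by
  rw [Bool.eq_iff_iff, gen_label_iff, gen_label_iff]
  refine exists_congr fun a => ?_
  rw [h.sameCircle_iff_of_not_near hy]
  by_cases ha : SameCircle I y a
  · rw [hστ a ((Near.congr ((h.sameCircle_iff_of_not_near hy).2 ha)).not.1 hy)]
  · simp [ha]

-- After a split, the predecessor has the same set of v₊ points, provided that they stay on distinct
-- circles. For a merge into a circle labelled v₋, the predecessors have one of the two old circles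
-- labelled v₊; for a merge into v₊, the unique predecessor has both.
open Classical in
theorem sum_incidentAt_gen {J I : Resolution w} {t : Crossing w} (hJ : J t = false)
    (hI : I = Function.update J t true) {σ : Finset (Point w)} (hσ : Indep I σ) (x : CKh w) :
    ∑ S : Generator w with IncidentAt t S (gen I σ), x S = edgeOp J t (ev J x) σ := by
  have hd : DifferAt t J I := hI ▸ (differAt_update (b := true) (by simpa using hJ)).symm
  have hres : ∀ S, IncidentAt t S (gen I σ) → S.res = J := fun S h => h.res_eq hJ hI
  by_cases hs : SameCircle J (cornerL t) (cornerR t)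
  · have hns := hd.sameCircle_corner_iff.1 hs
    rw [edgeOp_of_same hs]
    by_cases hb : ((gen I σ).label (cornerL t) && (gen I σ).label (cornerR t)) = true
    · rw [Finset.sum_eq_zero, ev, if_neg]
      · intro hind
        rw [Bool.and_eq_true, gen_label_iff, gen_label_iff] at hb
        obtain ⟨⟨a, ha, haL⟩, b, hb, hbR⟩ := hb
        have hab : a = b := hind a ha b hb
          ((hd.symm.sameCircle_mono hs haL.symm).trans (hs.trans (hd.symm.sameCircle_mono hs hbR)))
        subst hab
        exact hns (haL.trans hbR.symm)
      · intro S hS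
        rw [Finset.mem_filter] at hS
        have h1 := (IncidentAt.split_iff (by rw [hres S hS.2]; exact hs)).1 hS.2
        rw [hb] at h1
        simp at h1
    · have hboth : ∀ a ∈ σ, ∀ b ∈ σ, SameCircle I a (cornerL t) → ¬ SameCircle I b (cornerR t) := by
        intro a ha b hb' haL hbR
        refine hb ?_
        rw [Bool.and_eq_true, gen_label_iff, gen_label_iff]
        exact ⟨⟨a, ha, haL.symm⟩, b, hb', hbR.symm⟩
      have hind : Indep J σ := by
        intro a ha b hb' hab
        rcases hd.sameCircle_or_near hab with h | ⟨h1 | h1, h2 | h2⟩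
        · exact hσ a ha b hb' h
        · exact hσ a ha b hb' (h1.trans h2.symm)
        · exact absurd h2 (hboth a ha b hb' h1)
        · exact absurd h1 (hboth b hb' a ha h2)
        · exact hσ a ha b hb' (h1.trans h2.symm)
      have hL : (gen J σ).label (cornerL t) =
          ((gen I σ).label (cornerL t) || (gen I σ).label (cornerR t)) := by
        rw [Bool.eq_iff_iff, Bool.or_eq_true, gen_label_iff, gen_label_iff, gen_label_iff]
        constructor
        · rintro ⟨a, ha, h⟩
          rcases hd.near_iff.1 (Or.inl h.symm : Near J t a) with h | h
          · exact Or.inl ⟨a, ha, h.symm⟩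
          · exact Or.inr ⟨a, ha, h.symm⟩
        · rintro (⟨a, ha, h⟩ | ⟨a, ha, h⟩)
          · exact ⟨a, ha, hd.symm.sameCircle_mono hs h⟩
          · exact ⟨a, ha, hs.trans (hd.symm.sameCircle_mono hs h)⟩
      rw [ev, if_pos hind]
      refine Finset.sum_eq_single_of_mem _ ?_ ?_
      · rw [Finset.mem_filter, IncidentAt.split_iff (by exact hs)]
        exact ⟨Finset.mem_univ _, ⟨hJ, hI⟩, gen_label_congr hd fun _ _ => Iff.rfl, hL, by simpa using hb⟩
      · intro S hS hne
        rw [Finset.mem_filter] at hS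
        have hSJ := hres S hS.2
        have hsS : SameCircle S.res (cornerL t) (cornerR t) := hSJ ▸ hs
        have h1 := (IncidentAt.split_iff hsS).1 hS.2
        refine absurd (Generator.ext_of_near t hSJ ?_ ?_ ?_) hne
        · intro y hy
          rw [← h1.2.1 y hy]
          exact gen_label_congr hd (fun _ _ => Iff.rfl) y (hSJ ▸ hy)
        · rw [h1.2.2.1, hL]
        · rw [← SameCircle.label_eq S hsS, ← SameCircle.label_eq (gen J σ) hs, h1.2.2.1, hL]
  · have hsI := hd.symm.sameCircle_corner_iff.2 hs
    have hnear : ∀ {a b}, Near J t a → Near J t b → SameCircle I a b := by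
      have : ∀ {a}, Near J t a → SameCircle I a (cornerL t) := by
        rintro a (h | h)
        · exact hd.sameCircle_mono hsI h
        · exact (hd.sameCircle_mono hsI h).trans hsI.symm
      exact fun {_ _} ha hb => (this ha).trans (this hb).symm
    have hnL : Near J t (cornerL t) := Or.inl (.refl _ _)
    have hnR : Near J t (cornerR t) := Or.inr (.refl _ _)
    have hins : ∀ {τ : Finset (Point w)} {c : Point w}, Near J t c → ∀ a, ¬ Near J t a →
        (a ∈ insert c τ ↔ a ∈ τ) := by
      intro τ c hc a ha
      rw [Finset.mem_insert, or_iff_right]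
      rintro rfl
      exact ha hc
    rw [edgeOp_of_not_same hs, Pi.add_apply]
    by_cases hU : ∃ a ∈ σ, Near J t a
    · obtain ⟨a, ha, hna⟩ := hU
      have hUL : (gen I σ).label (cornerL t) = true :=
        (gen_label_iff _ _ _).2 ⟨a, ha, hnear hnL hna⟩
      set S₀ := gen J (insert (cornerL t) (insert (cornerR t) σ)) with hS₀
      have hL : S₀.label (cornerL t) = true :=
        (gen_label_iff _ _ _).2 ⟨cornerL t, by simp, .refl _ _⟩
      have hR : S₀.label (cornerR t) = true :=
        (gen_label_iff _ _ _).2 ⟨cornerR t, by simp, .refl _ _⟩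
      have hoff : ∀ y, ¬ Near J t y → (gen I σ).label y = S₀.label y :=
        gen_label_congr hd fun a ha => by rw [hins hnL a ha, hins hnR a ha]
      have hsum : ∑ S : Generator w with IncidentAt t S (gen I σ), x S = x S₀ := by
        refine Finset.sum_eq_single_of_mem _ ?_ ?_
        · rw [Finset.mem_filter, IncidentAt.merge_iff (by exact hs)]
          exact ⟨Finset.mem_univ _, ⟨hJ, hI⟩, hoff, by rw [hUL, hL, hR]; rfl, by rw [hL]; rfl⟩
        · intro S hS hne
          rw [Finset.mem_filter] at hS
          have hSJ := hres S hS.2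
          have h1 := (IncidentAt.merge_iff (by rw [hSJ]; exact hs)).1 hS.2
          rw [hUL] at h1
          have h2 := (Bool.and_eq_true _ _).mp h1.2.2.1.symm
          refine absurd (Generator.ext_of_near t hSJ ?_ ?_ ?_) hne
          · intro y hy
            rw [← h1.2.1 y hy, hoff y (hSJ ▸ hy)]
          · rw [h2.1, hL]
          · rw [h2.2, hR]
      -- The merged circle carries v₊, recorded by the point `a`. Inserting a point on the old
      -- circle of `a` contributes nothing; inserting one on the other old circle gives `S₀`.
      have key : ∀ {P Q : Point w}, Near J t P → Near J t Q → SameCircle J a P → ¬ SameCircle J P Q →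
          gen J (insert P (insert Q σ)) = S₀ →
          mulAt P (ev J x) σ = 0 ∧ mulAt Q (ev J x) σ = x S₀ := by
        intro P Q hP hQ haP hPQ hgen
        have hQa : ∀ d ∈ σ, ¬ SameCircle J Q d := by
          intro d hd' hQd
          have : d = a := hσ d hd' a ha (hnear ((Near.congr hQd).1 hQ) hna)
          exact hPQ ((hQd.trans (this ▸ haP)).symm)
        constructor
        · rw [mulAt_apply]
          split_ifs with hPσ
          · rfl
          · refine if_neg fun hi => hPσ ?_
            have := hi a (Finset.mem_insert_of_mem ha) P (Finset.mem_insert_self _ _) haP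
            exact this ▸ ha
        · rw [mulAt_apply, if_neg fun h => hQa Q h (.refl _ _), ev, if_pos, ← hgen]
          · congr 1
            refine Generator.ext rfl (funext fun y => ?_)
            rw [Bool.eq_iff_iff, gen_label_iff, gen_label_iff]
            constructor
            · rintro ⟨b, hb, h⟩
              exact ⟨b, Finset.mem_insert_of_mem hb, h⟩
            · rintro ⟨b, hb, h⟩
              rcases Finset.mem_insert.1 hb with rfl | hb
              · exact ⟨a, Finset.mem_insert_of_mem ha, h.trans haP.symm⟩
              · exact ⟨b, hb, h⟩
          · intro c hc d hd' hcd
            rcases Finset.mem_insert.1 hc with hc' | hc' <;>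
              rcases Finset.mem_insert.1 hd' with hd'' | hd''
            · rw [hc', hd'']
            · exact absurd (hc' ▸ hcd) (hQa d hd'')
            · exact absurd (hd'' ▸ hcd.symm) (hQa c hc')
            · exact hσ c hc' d hd'' (hd.sameCircle_mono hsI hcd)
      rw [hsum]
      rcases hna with hna | hna
      · obtain ⟨h1, h2⟩ := key hnL hnR hna hs rfl
        rw [h1, h2, zero_add]
      · obtain ⟨h1, h2⟩ := key hnR hnL hna (fun h => hs h.symm) (by rw [hS₀, Finset.insert_comm])
        rw [h1, h2, add_zero]
    · push Not at hU
      have hUL : (gen I σ).label (cornerL t) = false := by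
        rw [← Bool.not_eq_true, gen_label_iff]
        rintro ⟨a, ha, h⟩
        exact hU a ha (hd.near_iff.2 (Or.inl h.symm))
      have hval : ∀ {P : Point w}, Near J t P →
          mulAt P (ev J x) σ = x (gen J (insert P σ)) := by
        intro P hP
        have hPa : ∀ d ∈ σ, ¬ SameCircle J P d := fun d hd' h => hU d hd' ((Near.congr h).1 hP)
        rw [mulAt_apply, if_neg fun h => hU P h hP, ev, if_pos]
        intro c hc d hd' hcd
        rcases Finset.mem_insert.1 hc with hc' | hc' <;>
          rcases Finset.mem_insert.1 hd' with hd'' | hd''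
        · rw [hc', hd'']
        · exact absurd (hc' ▸ hcd) (hPa d hd'')
        · exact absurd (hd'' ▸ hcd.symm) (hPa c hc')
        · exact hσ c hc' d hd'' (hd.sameCircle_mono hsI hcd)
      have hlab : ∀ {P Q : Point w}, Near J t P → Near J t Q →
          ((gen J (insert P σ)).label Q = true ↔ SameCircle J Q P) := by
        intro P Q hP hQ
        rw [gen_label_iff]
        constructor
        · rintro ⟨b, hb, h⟩
          rcases Finset.mem_insert.1 hb with rfl | hb
          · exact h
          · exact absurd ((Near.congr h).1 hQ) (hU b hb)
        · exact fun h => ⟨P, Finset.mem_insert_self _ _, h⟩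
      have hLL := (hlab hnL hnL).2 (.refl _ _)
      have hRR := (hlab hnR hnR).2 (.refl _ _)
      have hLR := Bool.eq_false_iff.2 (mt (hlab hnL hnR).1 fun h => hs h.symm)
      have hRL := Bool.eq_false_iff.2 (mt (hlab hnR hnL).1 hs)
      have hoff : ∀ {P : Point w}, Near J t P → ∀ y, ¬ Near J t y →
          (gen I σ).label y = (gen J (insert P σ)).label y :=
        fun hP => gen_label_congr hd (hins hP)
      rw [hval hnL, hval hnR, ← Finset.sum_pair]
      · congr 1
        ext S
        simp only [Finset.mem_filter, Finset.mem_univ, true_and, Finset.mem_insert,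
          Finset.mem_singleton]
        constructor
        · intro hS
          have hSJ := hres S hS
          have h1 := (IncidentAt.merge_iff (by rw [hSJ]; exact hs)).1 hS
          have h2 := h1.2.2.1
          have h3 := h1.2.2.2
          rw [hUL] at h2
          rcases hSL : S.label (cornerL t) with _ | _ <;> rcases hSR : S.label (cornerR t) with _ | _
          · simp [hSL, hSR] at h3
          · right
            refine Generator.ext_of_near t hSJ ?_ (by rw [hSL, hRL]) (by rw [hSR, hRR])
            intro y hy
            rw [← h1.2.1 y hy, hoff hnR y (hSJ ▸ hy)]
          · left
            refine Generator.ext_of_near t hSJ ?_ (by rw [hSL, hLL]) (by rw [hSR, hLR])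
            intro y hy
            rw [← h1.2.1 y hy, hoff hnL y (hSJ ▸ hy)]
          · simp [hSL, hSR] at h2
        · rintro (rfl | rfl)
          · rw [IncidentAt.merge_iff (by exact hs)]
            exact ⟨⟨hJ, hI⟩, hoff hnL, by rw [hUL, hLL, hLR]; rfl, by rw [hLL]; rfl⟩
          · rw [IncidentAt.merge_iff (by exact hs)]
            exact ⟨⟨hJ, hI⟩, hoff hnR, by rw [hUL, hRL]; rfl, by rw [hRR, hRL]; rfl⟩
      · intro h
        rw [h] at hLL
        rw [hLL] at hRL
        cases hRL

/-- The edge operator must respect the extension by zero to dependent sets, so that edge operators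
can be composed without tracking independence. -/
theorem edgeOp_ev_of_not_indep {J I : Resolution w} {t : Crossing w} (hd : DifferAt t J I)
    {σ : Finset (Point w)} (hσ : ¬ Indep I σ) (x : CKh w) : edgeOp J t (ev J x) σ = 0 := by
  unfold Indep at hσ
  push Not at hσ
  obtain ⟨a, ha, b, hb, hab, hne⟩ := hσ
  by_cases hs : SameCircle J (cornerL t) (cornerR t)
  · rw [edgeOp_of_same hs]
    exact if_neg fun hi => hne (hi a ha b hb (hd.symm.sameCircle_mono hs hab))
  rw [edgeOp_of_not_same hs, Pi.add_apply]
  have key : ∀ {P Q : Point w}, SameCircle J a P ∨ SameCircle J a Q →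
      SameCircle J b P ∨ SameCircle J b Q → ¬ SameCircle J a b → mulAt P (ev J x) σ = 0 := by
    intro P Q haPQ hbPQ hnab
    rw [mulAt_apply]
    split_ifs with hP
    · rfl
    refine if_neg fun hi => ?_
    have h1 : ∀ c ∈ σ, ¬ SameCircle J c P := fun c hc h =>
      hP ((hi c (Finset.mem_insert_of_mem hc) P (Finset.mem_insert_self _ _) h) ▸ hc)
    rcases haPQ with h | h
    · exact h1 a ha h
    rcases hbPQ with h' | h'
    · exact h1 b hb h'
    exact hnab (h.trans h'.symm)
  by_cases hJ : SameCircle J a b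
  · have : ∀ P, mulAt P (ev J x) σ = 0 := by
      intro P
      rw [mulAt_apply]
      split_ifs
      · rfl
      · exact if_neg fun hi => hne
          (hi a (Finset.mem_insert_of_mem ha) b (Finset.mem_insert_of_mem hb) hJ)
    rw [this, this, add_zero]
  · rcases hd.symm.sameCircle_or_near hab with h | ⟨h1, h2⟩
    · exact absurd h hJ
    · rw [key h1 h2 hJ, key h1.symm h2.symm hJ, add_zero]

open Classical in
theorem ev_diff (I : Resolution w) (x : CKh w) (σ : Finset (Point w)) :
    ev I (diff w x) σ = ∑ t, if I t = true then
      edgeOp (Function.update I t false) t (ev (Function.update I t false) x) σ else 0 := by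
  by_cases hσ : Indep I σ
  · rw [ev, if_pos hσ, diff_apply]
    refine Finset.sum_congr rfl fun t _ => ?_
    split_ifs with ht
    · exact sum_incidentAt_gen (by simp) (by simp [← ht]) hσ x
    · refine Finset.sum_eq_zero fun S hS => ?_
      rw [Finset.mem_filter] at hS
      exact absurd (((update_eq_comm false).1 ⟨hS.2.1, hS.2.2.1⟩).1) ht
  · rw [ev, if_neg hσ, Finset.sum_eq_zero]
    intro t _
    split_ifs with ht
    · exact edgeOp_ev_of_not_indep (differAt_update (by simpa using ht)) hσ x
    · rfl

theorem sum_sum_eq_zero_of_symm {ι : Type*} [Fintype ι] [DecidableEq ι] (F : ι → ι → ZMod 2)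
    (h0 : ∀ i, F i i = 0) (hF : ∀ i j, F i j = F j i) : ∑ i, ∑ j, F i j = 0 := by
  rw [← Finset.sum_product']
  refine Finset.sum_involution (fun a _ => a.swap) ?_ ?_ (by simp) (by simp)
  · rintro ⟨i, j⟩ _
    simp only [Prod.fst_swap, Prod.snd_swap]
    rw [hF j i]
    exact CharTwo.add_self_eq_zero _
  · rintro ⟨i, j⟩ _ hne h
    simp only [Prod.swap_prod_mk, Prod.mk.injEq] at h
    exact hne (by rw [h.1]; exact h0 _)

theorem ev_zero_ext {x : CKh w} (h : ∀ I σ, ev I x σ = 0) : x = 0 := by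
  funext S
  obtain ⟨σ, hσ, hS⟩ := S.exists_gen_eq
  have := h S.res σ
  rw [ev, if_pos hσ, hS] at this
  exact this

/-- The Khovanov differential squares to zero. -/
theorem diff_diff (x : CKh w) : diff w (diff w x) = 0 := by
  classical
  refine ev_zero_ext fun I σ => ?_
  let R : Crossing w → Resolution w := fun t => Function.update I t false
  let F : Crossing w → Crossing w → ZMod 2 := fun t s =>
    if I t = true ∧ R t s = true then
      edgeOp (R t) t (edgeOp (Function.update (R t) s false) s
        (ev (Function.update (R t) s false) x)) σ else 0
  have hF : ev I (diff w (diff w x)) σ = ∑ t, ∑ s, F t s := by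
    rw [ev_diff]
    refine Finset.sum_congr rfl fun t _ => ?_
    split_ifs with ht
    · have : ev (R t) (diff w x) = ∑ s, if R t s = true then
          edgeOp (Function.update (R t) s false) s (ev (Function.update (R t) s false) x)
          else 0 := by
        funext τ
        rw [ev_diff, Finset.sum_apply]
        refine Finset.sum_congr rfl fun s _ => ?_
        split_ifs <;> rfl
      change edgeOp (R t) t (ev (R t) (diff w x)) σ = _
      rw [this, map_sum, Finset.sum_apply]
      refine Finset.sum_congr rfl fun s _ => ?_
      simp only [F, ht, true_and]
      split_ifs
      · rfl
      · simp
    · simp [F, ht]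
  rw [hF]
  refine sum_sum_eq_zero_of_symm F (fun t => by simp [F, R]) fun t s => ?_
  by_cases hts : t = s
  · rw [hts]
  by_cases h : I t = true ∧ I s = true
  · have h1 : R t s = true := by simp [R, Ne.symm hts, h.2]
    have h2 : R s t = true := by simp [R, hts, h.1]
    simp only [F, h, h1, h2, and_self, if_true]
    have hK : Function.update (R t) s false = Function.update (R s) t false :=
      (Function.update_comm hts _ _ _)
    have e1 : DifferAt s (Function.update (R t) s false) (R t) := differAt_update (by simpa using h1)
    have e2 : DifferAt t (Function.update (R s) t false) (R s) := differAt_update (by simpa using h2)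
    have e3 : DifferAt t (R t) I := differAt_update (by simpa using h.1)
    have e4 : DifferAt s (R s) I := differAt_update (by simpa using h.2)
    rw [hK] at e1 ⊢
    rw [edgeOp_edgeOp_comm e1 e2 e3 e4]
  · have h1 : ¬ (I t = true ∧ R t s = true) := by
      simp only [R, Function.update_of_ne (Ne.symm hts)]
      exact h
    have h2 : ¬ (I s = true ∧ R s t = true) := by
      simp only [R, Function.update_of_ne hts]
      tauto
    simp only [F, h1, h2, if_false]

end DiffSq

/-! ### Dimension counts for subquotients. -/

section LinearAlgebra

open Module

variable {K V : Type*} [Field K] [AddCommGroup V] [Module K V] [FiniteDimensional K V]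

theorem finrank_quotient_submoduleOf (p q : Submodule K V) :
    finrank K (↥p ⧸ q.submoduleOf p) + finrank K ↥(p ⊓ q) = finrank K p := by
  rw [← Submodule.finrank_quotient_add_finrank (q.submoduleOf p), Submodule.submoduleOf,
    ← Submodule.map_comap_subtype,
    ← (Submodule.equivMapOfInjective p.subtype p.injective_subtype (q.comap p.subtype)).finrank_eq]

/-- The quotient of `z` by `z ⊓ q` embeds into that of `p` by `p ⊓ q`. -/
theorem finrank_le_finrank_quotient_add (z p q : Submodule K V) (h : z ≤ p) :
    finrank K z ≤ finrank K (↥p ⧸ q.submoduleOf p) + finrank K ↥(z ⊓ q) := by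
  have h1 := finrank_quotient_submoduleOf p q
  have h2 := Submodule.finrank_sup_add_finrank_inf_eq z (p ⊓ q)
  have h3 : finrank K ↥(z ⊔ p ⊓ q) ≤ finrank K p :=
    Submodule.finrank_mono (sup_le h inf_le_left)
  rw [← inf_assoc, inf_eq_left.2 h] at h2
  omega

theorem sum_Icc_sub_int (f : ℤ → ℤ) {a b : ℤ} (hab : a - 1 ≤ b) :
    ∑ m ∈ Finset.Icc a b, (f m - f (m - 1)) = f b - f (a - 1) := by
  induction b, hab using Int.leInduction with
  | base => simp
  | succ b hab ih =>
    have : Finset.Icc a (b + 1) = insert (b + 1) (Finset.Icc a b) := by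
      ext m
      simp only [Finset.mem_Icc, Finset.mem_insert]
      omega
    rw [this, Finset.sum_insert (by simp), ih]
    simp

end LinearAlgebra

/-! ### The annular filtration, and the pages compared with Khovanov homology. -/

section Filtration

variable {n : ℕ} (w : BraidWord n)

theorem spanOf_mono {P Q : Generator w → Prop} (h : ∀ S, P S → Q S) : spanOf P ≤ spanOf Q :=
  fun _ hx S hS => hx S fun hP => hS (h S hP)

theorem filt_mono {i j : ℤ} (h : i ≤ j) : filt w i ≤ filt w j :=
  spanOf_mono w fun _ hS => le_trans hS h

variable {w}

/-- A non-trivial circle meets γ, hence contains one of the `n` closing arcs. This makes the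
filtration finite. -/
theorem ncard_nontrivial_le {I : Resolution w} (s : Set (Circle I)) (hs : ∀ c ∈ s, c.Nontrivial) :
    s.ncard ≤ n := by
  have : s ⊆ (fun j : Fin n => (⟦((Fin.last w.length, j) : Point w)⟧ : Circle I)) '' Set.univ := by
    intro c hc
    obtain ⟨j, hj⟩ := Set.nonempty_of_ncard_ne_zero (hs c hc).pos.ne'
    exact ⟨j, trivial, hj⟩
  calc s.ncard ≤ _ := Set.ncard_le_ncard this (Set.toFinite _)
    _ ≤ (Set.univ : Set (Fin n)).ncard := Set.ncard_image_le
    _ = n := by rw [Set.ncard_univ, Nat.card_eq_fintype_card, Fintype.card_fin]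

theorem Generator.neg_le_k (S : Generator w) : -(n : ℤ) ≤ S.k := by
  have := ncard_nontrivial_le {c : Circle S.res | c.Nontrivial ∧ S.circleLabel c = false}
    fun c hc => hc.1
  unfold Generator.k
  omega

theorem Generator.k_le (S : Generator w) : S.k ≤ n := by
  have := ncard_nontrivial_le {c : Circle S.res | c.Nontrivial ∧ S.circleLabel c = true}
    fun c hc => hc.1
  unfold Generator.k
  omega

variable (w)

theorem filt_eq_top {i : ℤ} (h : (n : ℤ) ≤ i) : filt w i = ⊤ :=
  eq_top_iff.2 fun _ _ S hS => absurd (S.k_le.trans h) hS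

theorem filt_eq_bot {i : ℤ} (h : i < -(n : ℤ)) : filt w i = ⊥ :=
  eq_bot_iff.2 fun x hx => by
    rw [Submodule.mem_bot]
    funext S
    refine hx S ?_
    have := S.neg_le_k
    omega

/-- If `a + d y` is a cycle then so is `a`, as d² = 0. Hence a cycle of level `m` that is zero in
E^r is also zero in the graded piece of level `m` of homology. -/
theorem cycles_inf_pageDen_le (r : ℕ) (h m : ℤ) :
    cycles w h ⊓ filt w m ⊓ pageDen w r h m ≤
      cycles w h ⊓ filt w (m - 1) ⊔
        cycles w h ⊓ filt w m ⊓ (CKhDeg w (h - 1)).map (diff w) := by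
  rintro x ⟨⟨⟨hx, hdx⟩, hxm⟩, hden⟩
  obtain ⟨a, ⟨ha, hah⟩, b, ⟨y, hy, rfl⟩, rfl⟩ := Submodule.mem_sup.1 hden
  have hdd : diff w (diff w y) = 0 := diff_diff y
  have hb : diff w y ∈ CKhDeg w h := by simpa using Submodule.sub_mem _ hx hah
  have hbm : diff w y ∈ filt w m := by
    simpa using Submodule.sub_mem _ hxm (filt_mono w (by omega) ha)
  refine Submodule.add_mem_sup ⟨⟨hah, ?_⟩, ha⟩ ⟨⟨⟨hb, hdd⟩, hbm⟩, y, hy.2, rfl⟩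
  have : diff w (a + diff w y) = 0 := hdx
  rw [map_add, hdd, add_zero] at this
  exact this

theorem cycles_inf_filt_le_pageNum (r : ℕ) (h m : ℤ) :
    cycles w h ⊓ filt w m ≤ pageNum w r h m := by
  rintro x ⟨⟨hx, hdx⟩, hxm⟩
  refine ⟨⟨hxm, hx⟩, ?_⟩
  change diff w x ∈ filt w (m - r)
  rw [LinearMap.mem_ker.1 hdx]
  exact zero_mem _

open Module in
/-- A cycle in the filtration level `m` which is a boundary but does not represent zero in
`E^r_{h,m}` makes the total dimension of `E^r_h` larger than that of Khovanov homology. -/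
theorem finrank_kh_lt_sum_finrank_page {r : ℕ} {h m₀ : ℤ} (hm₀ : m₀ ∈ Finset.Icc (-(n : ℤ)) n)
    {x : CKh w} (hx : x ∈ cycles w h) (hxm : x ∈ filt w m₀)
    (hxB : x ∈ (CKhDeg w (h - 1)).map (diff w)) (hxD : x ∉ pageDen w r h m₀) :
    finrank (ZMod 2) (Kh w h) <
      ∑ m ∈ Finset.Icc (-(n : ℤ)) n, finrank (ZMod 2) (Page w r h m) := by
  set B := (CKhDeg w (h - 1)).map (diff w) with hB
  let Z : ℤ → Submodule (ZMod 2) (CKh w) := fun m => cycles w h ⊓ filt w m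
  -- `f m` is the dimension of the image of `Z m` in homology, so its increments are the dimensions
  -- of the graded pieces. They telescope to the dimension of Kh.
  let f : ℤ → ℤ := fun m => (finrank (ZMod 2) (Z m) : ℤ) - finrank (ZMod 2) ↥(Z m ⊓ B)
  have hle : ∀ m, Z m ⊓ pageDen w r h m ≤ Z (m - 1) ⊔ Z m ⊓ B :=
    fun m => cycles_inf_pageDen_le w r h m
  have hdim : ∀ m, (finrank (ZMod 2) ↥(Z (m - 1) ⊔ Z m ⊓ B) : ℤ) =
      finrank (ZMod 2) (Z (m - 1)) + finrank (ZMod 2) ↥(Z m ⊓ B) -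
        finrank (ZMod 2) ↥(Z (m - 1) ⊓ B) := by
    intro m
    have h1 := Submodule.finrank_sup_add_finrank_inf_eq (Z (m - 1)) (Z m ⊓ B)
    have h2 : Z (m - 1) ≤ Z m := inf_le_inf_left _ (filt_mono w (by omega))
    rw [← inf_assoc, inf_eq_left.2 h2] at h1
    omega
  have hpage : ∀ m, (finrank (ZMod 2) (Z m) : ℤ) ≤ finrank (ZMod 2) (Page w r h m) +
      finrank (ZMod 2) ↥(Z m ⊓ pageDen w r h m) := fun m => by
    exact_mod_cast finrank_le_finrank_quotient_add _ _ (pageDen w r h m)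
      (cycles_inf_filt_le_pageNum w r h m)
  have hstep : ∀ m, f m - f (m - 1) ≤ finrank (ZMod 2) (Page w r h m) := by
    intro m
    have h1 := Submodule.finrank_mono (hle m)
    have h2 := hdim m
    have h3 := hpage m
    simp only [f]
    omega
  have hstrict : f m₀ - f (m₀ - 1) < finrank (ZMod 2) (Page w r h m₀) := by
    -- The boundary `x` is zero in the graded piece of homology but not in the page, which makes the
    -- inequality strict at `m₀`.
    have hlt : Z m₀ ⊓ pageDen w r h m₀ < Z (m₀ - 1) ⊔ Z m₀ ⊓ B := by
      refine lt_of_le_of_ne (hle m₀) fun heq => hxD ?_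
      have : x ∈ Z (m₀ - 1) ⊔ Z m₀ ⊓ B := Submodule.mem_sup_right ⟨⟨hx, hxm⟩, hxB⟩
      rw [← heq] at this
      exact this.2
    have h1 := Submodule.finrank_lt_finrank_of_lt hlt
    have h2 := hdim m₀
    have h3 := hpage m₀
    simp only [f]
    omega
  have hsum := Finset.sum_lt_sum (s := Finset.Icc (-(n : ℤ)) n) (fun m _ => hstep m) ⟨m₀, hm₀, hstrict⟩
  rw [sum_Icc_sub_int f (by omega)] at hsum
  have hZn : Z n = cycles w h := by simp [Z, filt_eq_top w le_rfl]
  have hZ0 : Z (-(n : ℤ) - 1) = ⊥ := by simp [Z, filt_eq_bot w (show -(n : ℤ) - 1 < -n by omega)]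
  have hf0 : f (-(n : ℤ) - 1) = 0 := by
    change (finrank (ZMod 2) (Z (-(n : ℤ) - 1)) : ℤ) - finrank (ZMod 2) ↥(Z (-(n : ℤ) - 1) ⊓ B) = 0
    rw [hZ0, bot_inf_eq, sub_self]
  have hfn : f n = finrank (ZMod 2) (Kh w h) := by
    have : finrank (ZMod 2) (Kh w h) + finrank (ZMod 2) ↥(cycles w h ⊓ B) =
        finrank (ZMod 2) ↥(cycles w h) := finrank_quotient_submoduleOf (cycles w h) B
    change (finrank (ZMod 2) (Z n) : ℤ) - finrank (ZMod 2) ↥(Z n ⊓ B) = _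
    rw [hZn]
    omega
  rw [hf0, hfn, sub_zero] at hsum
  exact_mod_cast hsum

end Filtration

/-- The consequences of the fact that the element `ψ` of a braid on four strands is the boundary of
a chain in `𝓕₀` but not of a chain in `𝓕₋₁`. -/
theorem consequences_of_psi_boundary (w : BraidWord 4) {x : CKh w} (hx : x ∈ filt w 0)
    (hxh : x ∈ CKhDeg w 3) (hdx : diff w x = psi w) (hψk : psi w ∈ filt w (-4))
    (hψh : psi w ∈ CKhDeg w 4) (hψ : psi w ∉ (filt w (-1)).map (diff w)) :
    kappa w = ((4 : ℤ) : WithTop ℤ) ∧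
    (∃ hE : psi w ∈ pageNum w 3 4 (-4),
      (Submodule.Quotient.mk ⟨psi w, hE⟩ : Page w 3 4 (-4)) ≠ 0) ∧
    (∃ hK : psi w ∈ cycles w 4, (Submodule.Quotient.mk ⟨psi w, hK⟩ : Kh w 4) = 0) ∧
    IsEmpty (Kh w 4 ≃ₗ[ZMod 2]
      DirectSum (Finset.Icc (-4 : ℤ) 4) (fun m => Page w 3 4 (m : ℤ))) ∧
    ¬ CollapsesAt w 3 := by
  have hcyc : psi w ∈ cycles w 4 := ⟨hψh, LinearMap.mem_ker.2 (by rw [← hdx, diff_diff])⟩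
  have hbd : psi w ∈ (CKhDeg w (4 - 1)).map (diff w) := ⟨x, hxh, hdx⟩
  -- Since 𝓕₋₅ = 0, only d(𝓕_{r-5}) is left of the denominator, and r - 5 ≤ -1.
  have hden : ∀ r : ℕ, r ≤ 4 → psi w ∉ pageDen w r 4 (-4) := by
    intro r hr hmem
    rw [pageDen, filt_eq_bot w (by norm_num), bot_inf_eq, bot_sup_eq] at hmem
    exact hψ (Submodule.map_mono (inf_le_left.trans (filt_mono w (by omega))) hmem)
  have hnum := cycles_inf_filt_le_pageNum w 3 4 (-4) ⟨hcyc, hψk⟩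
  refine ⟨?_, ⟨hnum, ?_⟩, ⟨hcyc, ?_⟩, ⟨fun e => ?_⟩, fun hcol => ?_⟩
  · rw [kappa, if_pos ⟨x, hdx⟩]
    have : sInf {i : ℤ | PsiVanishesIn w i} = 0 := by
      have h0 : (0 : ℤ) ∈ {i : ℤ | PsiVanishesIn w i} :=
        ⟨filt_mono w (by norm_num) hψk, x, hx, hdx⟩
      have hlow : ∀ i ∈ {i : ℤ | PsiVanishesIn w i}, 0 ≤ i := by
        intro i hi
        by_contra hneg
        exact hψ (Submodule.map_mono (filt_mono w (by omega)) hi.2)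
      exact le_antisymm (csInf_le ⟨0, hlow⟩ h0) (le_csInf ⟨0, h0⟩ hlow)
    rw [this]
    norm_num
  · rw [Ne, Submodule.Quotient.mk_eq_zero]
    exact hden 3 (by norm_num)
  · rw [Submodule.Quotient.mk_eq_zero]
    exact hbd
  · have hlt := finrank_kh_lt_sum_finrank_page w (r := 3) (h := 4) (m₀ := -4) (by simp) hcyc hψk hbd
      (hden 3 (by norm_num))
    have hfree : ∀ m : ℤ, Module.Free (ZMod 2) (Page w 3 4 m) := fun m => .of_divisionRing _ _
    have heq := e.finrank_eq
    rw [Module.finrank_directSum,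
      Finset.sum_coe_sort (Finset.Icc (-4 : ℤ) 4) fun m => Module.finrank (ZMod 2) (Page w 3 4 m)] at heq
    exact hlt.ne heq
  -- The differential d⁴ from E⁴_{3,0} to E⁴_{4,-4} sends [x] to [ψ], so its vanishing would put ψ
  -- into the denominator.
  · refine hden 4 le_rfl ?_
    have := hcol 4 (by norm_num) 3 0 x ⟨⟨hx, hxh⟩, ?_⟩
    · rw [hdx] at this
      simpa using this
    · change diff w x ∈ filt w (0 - (4 : ℕ))
      rw [hdx]
      simpa using hψk

/-! ### Disjoint sets of points as bit masks. -/

section BitMasks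

/-- Join the bit mask `e` with all masks of the list that it meets. -/
def joinMask : List ℕ → ℕ → List ℕ
  | [], e => [e]
  | b :: l, e => if b &&& e = 0 then b :: joinMask l e else joinMask l (b ||| e)

theorem and_eq_zero_iff (a b : ℕ) : a &&& b = 0 ↔ ∀ i, a.testBit i = true → b.testBit i = false := by
  constructor
  · intro h i ha
    have := congrArg (fun m => Nat.testBit m i) h
    simpa [ha] using this
  · intro h
    refine Nat.eq_of_testBit_eq fun i => ?_
    rw [Nat.testBit_and, Nat.zero_testBit]
    cases ha : a.testBit i
    · rfl
    · rw [h i ha]; rfl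

theorem or_and_eq_zero_iff (a b c : ℕ) : c &&& (a ||| b) = 0 ↔ c &&& a = 0 ∧ c &&& b = 0 := by
  rw [Nat.and_or_distrib_left, Nat.or_eq_zero_iff]

theorem joinMask_disjoint {l : List ℕ} {c e : ℕ} (hl : ∀ b ∈ l, c &&& b = 0) (he : c &&& e = 0) :
    ∀ b ∈ joinMask l e, c &&& b = 0 := by
  induction l generalizing e with
  | nil => simpa [joinMask] using he
  | cons a l ih =>
    have ha := hl a List.mem_cons_self
    have hl' : ∀ b ∈ l, c &&& b = 0 := fun b hb => hl b (List.mem_cons_of_mem _ hb)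
    rw [joinMask]
    split_ifs with h
    · intro b hb
      rcases List.mem_cons.1 hb with rfl | hb
      · exact ha
      · exact ih hl' he b hb
    · exact ih hl' ((or_and_eq_zero_iff _ _ _).2 ⟨ha, he⟩)

theorem joinMask_pairwise {l : List ℕ} (e : ℕ) (hl : l.Pairwise fun a b => a &&& b = 0) :
    (joinMask l e).Pairwise fun a b => a &&& b = 0 := by
  induction l generalizing e with
  | nil => simp [joinMask]
  | cons a l ih =>
    rw [List.pairwise_cons] at hl
    rw [joinMask]
    split_ifs with h
    · exact List.pairwise_cons.2 ⟨joinMask_disjoint hl.1 h, ih e hl.2⟩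
    · exact ih _ hl.2

theorem exists_joinMask_of_subset {l : List ℕ} {c e : ℕ} (h : c ∈ e :: l) :
    ∃ b ∈ joinMask l e, ∀ i, c.testBit i = true → b.testBit i = true := by
  induction l generalizing e c with
  | nil =>
    rw [List.mem_singleton] at h
    exact ⟨e, by simp [joinMask], by rw [h]; exact fun _ => id⟩
  | cons a l ih =>
    rw [joinMask]
    split_ifs with hae
    · rcases List.mem_cons.1 h with rfl | h
      · obtain ⟨b, hb, hcb⟩ := ih (List.mem_cons_self (a := c) (l := l))
        exact ⟨b, List.mem_cons_of_mem _ hb, hcb⟩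
      · rcases List.mem_cons.1 h with rfl | h
        · exact ⟨c, List.mem_cons_self, fun _ => id⟩
        · obtain ⟨b, hb, hcb⟩ := ih (e := e) (List.mem_cons_of_mem _ h)
          exact ⟨b, List.mem_cons_of_mem _ hb, hcb⟩
    · have key : ∀ c', (∀ i, c.testBit i = true → c'.testBit i = true) → c' ∈ (a ||| e) :: l →
          ∃ b ∈ joinMask l (a ||| e), ∀ i, c.testBit i = true → b.testBit i = true := by
        intro c' hcc' hc'
        obtain ⟨b, hb, hcb⟩ := ih hc'
        exact ⟨b, hb, fun i hi => hcb i (hcc' i hi)⟩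
      rcases List.mem_cons.1 h with rfl | h
      · exact key (a ||| c) (fun i hi => by simp [hi]) List.mem_cons_self
      · rcases List.mem_cons.1 h with rfl | h
        · exact key (c ||| e) (fun i hi => by simp [hi]) List.mem_cons_self
        · exact key c (fun _ => id) (List.mem_cons_of_mem _ h)

/-- A property of masks that passes to unions of masks that meet is kept by `joinMask`. -/
theorem forall_joinMask {P : ℕ → Prop} (hP : ∀ a b, P a → P b → a &&& b ≠ 0 → P (a ||| b))
    {l : List ℕ} {e : ℕ} (hl : ∀ b ∈ l, P b) (he : P e) : ∀ b ∈ joinMask l e, P b := by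
  induction l generalizing e with
  | nil => simpa [joinMask] using he
  | cons a l ih =>
    have ha := hl a List.mem_cons_self
    have hl' : ∀ b ∈ l, P b := fun b hb => hl b (List.mem_cons_of_mem _ hb)
    rw [joinMask]
    split_ifs with h
    · intro b hb
      rcases List.mem_cons.1 hb with rfl | hb
      · exact ha
      · exact ih hl' he b hb
    · exact ih hl' (hP _ _ ha he h)

theorem eq_of_common_testBit {l : List ℕ} (hl : l.Pairwise fun a b => a &&& b = 0) {b b' i : ℕ}
    (hb : b ∈ l) (hb' : b' ∈ l) (hi : b.testBit i = true) (hi' : b'.testBit i = true) : b = b' := by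
  by_contra hne
  have : Std.Symm fun a b : ℕ => a &&& b = 0 := ⟨fun _ _ h => by rwa [Nat.and_comm]⟩
  have : b &&& b' = 0 := hl.forall hb hb' hne
  rw [and_eq_zero_iff] at this
  rw [this i hi] at hi'
  cases hi'

/-- The mask in the list that contains the bit `i`, or the singleton if there is none. -/
def findMask (l : List ℕ) (i : ℕ) : ℕ := (l.find? fun b => b.testBit i).getD (2 ^ i)

theorem findMask_testBit {l : List ℕ} (hl : l.Pairwise fun a b => a &&& b = 0) (i j : ℕ) :
    (findMask l i).testBit j = true ↔ j = i ∨ ∃ b ∈ l, b.testBit i = true ∧ b.testBit j = true := by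
  unfold findMask
  cases hf : l.find? fun b => b.testBit i with
  | none =>
    rw [List.find?_eq_none] at hf
    rw [Option.getD_none, Nat.testBit_two_pow, decide_eq_true_eq, eq_comm, iff_self_or]
    rintro ⟨b, hb, hi, _⟩
    exact absurd hi (hf b hb)
  | some b =>
    have hb := List.mem_of_find?_eq_some hf
    have hbi : b.testBit i = true := by simpa using List.find?_some hf
    rw [Option.getD_some]
    constructor
    · exact fun h => Or.inr ⟨b, hb, hbi, h⟩
    · rintro (rfl | ⟨b', hb', hi, hj⟩)
      · exact hbi
      · have : b = b' := eq_of_common_testBit hl hb hb' hbi hi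
        exact this ▸ hj

/-- Set the bits of `L` in the mask `m` to `b`. -/
def setMask (L m : ℕ) (b : Bool) : ℕ := if b then L ||| m else L ^^^ (L &&& m)

theorem setMask_testBit (L m : ℕ) (b : Bool) (i : ℕ) :
    (setMask L m b).testBit i = if m.testBit i then b else L.testBit i := by
  unfold setMask
  cases b <;> cases hm : m.testBit i <;> cases hL : L.testBit i <;> simp [hm, hL]

end BitMasks

/-! ### Computing the circles of a resolution. -/

section Codes

variable {n : ℕ} {w : BraidWord n}

/-- The bit that belongs to a point. -/
def bit (x : Point w) : ℕ := n * x.1.val + x.2.val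

theorem bit_injective : Function.Injective (bit : Point w → ℕ) := by
  rintro ⟨s, j⟩ ⟨s', j'⟩ h
  simp only [bit] at h
  have hn : 0 < n := by have := j.2; omega
  have h1 : s.val = s'.val := by
    have := congrArg (· / n) h
    simpa [Nat.mul_add_div hn, Nat.div_eq_of_lt j.2, Nat.div_eq_of_lt j'.2] using this
  have h2 : j.val = j'.val := by rw [h1] at h; omega
  exact Prod.ext (Fin.ext h1) (Fin.ext h2)

/-- The resolution whose `1`-resolved crossings are given by a bit mask. -/
def resOf (w : BraidWord n) (m : ℕ) : Resolution w := fun t => m.testBit t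

/-- The arcs of the resolution `resOf w m`. -/
def arcList (w : BraidWord n) (m : ℕ) : List (Point w × Point w) :=
  (List.finRange w.length).flatMap (fun t =>
    (((List.finRange n).filter fun j => decide (j ≠ leftPos t ∧ j ≠ rightPos t)).map fun j =>
      ((t.castSucc, j), (t.succ, j))) ++
    (if m.testBit t = !(w.get t).2 then
      [((t.castSucc, leftPos t), (t.succ, leftPos t)),
        ((t.castSucc, rightPos t), (t.succ, rightPos t))]
    else [((t.castSucc, leftPos t), (t.castSucc, rightPos t)),
        ((t.succ, leftPos t), (t.succ, rightPos t))])) ++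
  (List.finRange n).map fun j => ((Fin.last w.length, j), (0, j))

theorem mem_arcList {m : ℕ} {x y : Point w} : (x, y) ∈ arcList w m ↔ Arc (resOf w m) x y := by
  have hb : ∀ t : Crossing w, (resOf w m).Braidlike t ↔ m.testBit t = !(w.get t).2 :=
    fun t => Iff.rfl
  rw [arcList, List.mem_append, List.mem_flatMap, List.mem_map]
  constructor
  · rintro (⟨t, -, h⟩ | ⟨j, -, h⟩)
    · rw [List.mem_append, List.mem_map] at h
      rcases h with ⟨j, hj, h⟩ | h
      · obtain ⟨rfl, rfl⟩ := Prod.mk.inj h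
        have := (List.mem_filter.1 hj).2
        rw [decide_eq_true_eq] at this
        exact .strand t j this.1 this.2
      · split_ifs at h with ht
        · rcases List.mem_cons.1 h with h | h
          · obtain ⟨rfl, rfl⟩ := Prod.mk.inj h
            exact .through_left t ((hb t).2 ht)
          · obtain ⟨rfl, rfl⟩ := Prod.mk.inj (List.mem_singleton.1 h)
            exact .through_right t ((hb t).2 ht)
        · rcases List.mem_cons.1 h with h | h
          · obtain ⟨rfl, rfl⟩ := Prod.mk.inj h
            exact .turn_bottom t (mt (hb t).1 ht)
          · obtain ⟨rfl, rfl⟩ := Prod.mk.inj (List.mem_singleton.1 h)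
            exact .turn_top t (mt (hb t).1 ht)
    · obtain ⟨rfl, rfl⟩ := Prod.mk.inj h
      exact .closing j
  · intro h
    cases h with
    | strand t j hl hr =>
      refine Or.inl ⟨t, List.mem_finRange t, List.mem_append_left _ (List.mem_map.2 ⟨j, ?_, rfl⟩)⟩
      simp [hl, hr]
    | through_left t h =>
      refine Or.inl ⟨t, List.mem_finRange t, List.mem_append_right _ ?_⟩
      rw [if_pos ((hb t).1 h)]
      simp
    | through_right t h =>
      refine Or.inl ⟨t, List.mem_finRange t, List.mem_append_right _ ?_⟩
      rw [if_pos ((hb t).1 h)]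
      simp
    | turn_bottom t h =>
      refine Or.inl ⟨t, List.mem_finRange t, List.mem_append_right _ ?_⟩
      rw [if_neg (mt (hb t).2 h)]
      simp
    | turn_top t h =>
      refine Or.inl ⟨t, List.mem_finRange t, List.mem_append_right _ ?_⟩
      rw [if_neg (mt (hb t).2 h)]
      simp
    | closing j => exact Or.inr ⟨j, List.mem_finRange j, rfl⟩

/-- The masks of the circles of the resolution `resOf w m`. -/
def circles (w : BraidWord n) (m : ℕ) : List ℕ :=
  (arcList w m).foldl (fun l a => joinMask l (2 ^ bit a.1 ||| 2 ^ bit a.2)) []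

theorem circles_spec (m : ℕ) :
    ((circles w m).Pairwise fun a b => a &&& b = 0) ∧
    (∀ x y, Arc (resOf w m) x y →
      ∃ b ∈ circles w m, b.testBit (bit x) = true ∧ b.testBit (bit y) = true) ∧
    ∀ b ∈ circles w m, ∃ x : Point w, ∀ i, b.testBit i = true →
      ∃ y, bit y = i ∧ SameCircle (resOf w m) x y := by
  let step : List ℕ → Point w × Point w → List ℕ :=
    fun l a => joinMask l (2 ^ bit a.1 ||| 2 ^ bit a.2)
  let P : ℕ → Prop := fun b => ∃ x : Point w, ∀ i, b.testBit i = true →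
      ∃ y, bit y = i ∧ SameCircle (resOf w m) x y
  have hP : ∀ a b, P a → P b → a &&& b ≠ 0 → P (a ||| b) := by
    rintro a b ⟨x, hx⟩ ⟨x', hx'⟩ hab
    rw [Ne, and_eq_zero_iff] at hab
    push Not at hab
    obtain ⟨i, hai, hbi⟩ := hab
    obtain ⟨y, hy, hxy⟩ := hx i hai
    obtain ⟨y', hy', hxy'⟩ := hx' i (by simpa using hbi)
    have : y = y' := bit_injective (hy.trans hy'.symm)
    subst this
    refine ⟨x, fun k hk => ?_⟩
    rw [Nat.testBit_or, Bool.or_eq_true] at hk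
    rcases hk with hk | hk
    · exact hx k hk
    · obtain ⟨z, hz, hxz⟩ := hx' k hk
      exact ⟨z, hz, hxy.trans (hxy'.symm.trans hxz)⟩
  -- Invariants of the fold, for any initial list: the masks stay disjoint, every arc processed lies
  -- in one mask, masks only grow, and each mask stays within one circle.
  suffices H : ∀ (L : List (Point w × Point w)) (l : List ℕ),
      (∀ x y, (x, y) ∈ L → Arc (resOf w m) x y) → (l.Pairwise fun a b => a &&& b = 0) →
      (∀ b ∈ l, P b) →
      ((L.foldl step l).Pairwise fun a b => a &&& b = 0) ∧
      (∀ x y, (x, y) ∈ L → ∃ b ∈ L.foldl step l,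
        b.testBit (bit x) = true ∧ b.testBit (bit y) = true) ∧
      (∀ c ∈ l, ∃ b ∈ L.foldl step l, ∀ i, c.testBit i = true → b.testBit i = true) ∧
      ∀ b ∈ L.foldl step l, P b by
    obtain ⟨h1, h2, -, h4⟩ := H (arcList w m) [] (fun x y h => mem_arcList.1 h) List.Pairwise.nil
      (by simp)
    exact ⟨h1, fun x y h => h2 x y (mem_arcList.2 h), h4⟩
  intro L
  induction L with
  | nil =>
    intro l _ hl hlP
    exact ⟨hl, by simp, fun c hc => ⟨c, hc, fun _ => id⟩, hlP⟩
  | cons a L ih =>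
    intro l hL hl hlP
    obtain ⟨u, v⟩ := a
    have huv : P (2 ^ bit u ||| 2 ^ bit v) := by
      refine ⟨u, fun i hi => ?_⟩
      rw [Nat.testBit_or, Nat.testBit_two_pow, Nat.testBit_two_pow, Bool.or_eq_true,
        decide_eq_true_eq, decide_eq_true_eq] at hi
      rcases hi with hi | hi
      · exact ⟨u, hi, .refl _ _⟩
      · exact ⟨v, hi, .of_arc (hL u v List.mem_cons_self)⟩
    obtain ⟨h1, h2, h3, h4⟩ := ih (step l (u, v)) (fun x y h => hL x y (List.mem_cons_of_mem _ h))
      (joinMask_pairwise _ hl) (forall_joinMask hP hlP huv)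
    have h5 : ∀ c ∈ (2 ^ bit u ||| 2 ^ bit v) :: l, ∃ b ∈ L.foldl step (step l (u, v)),
        ∀ i, c.testBit i = true → b.testBit i = true := by
      intro c hc
      obtain ⟨b, hb, hcb⟩ := exists_joinMask_of_subset hc
      obtain ⟨b', hb', hbb'⟩ := h3 b hb
      exact ⟨b', hb', fun i hi => hbb' i (hcb i hi)⟩
    refine ⟨h1, ?_, fun c hc => h5 c (List.mem_cons_of_mem _ hc), h4⟩
    intro x y hxy
    rcases List.mem_cons.1 hxy with h | h
    · obtain ⟨rfl, rfl⟩ := Prod.mk.inj h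
      obtain ⟨b, hb, hcb⟩ := h5 _ List.mem_cons_self
      exact ⟨b, hb, hcb _ (by simp [Nat.testBit_two_pow]), hcb _ (by simp [Nat.testBit_two_pow])⟩
    · exact h2 x y h

theorem findMask_circles (m : ℕ) (p x : Point w) :
    (findMask (circles w m) (bit p)).testBit (bit x) = true ↔ SameCircle (resOf w m) x p := by
  obtain ⟨h1, h2, h3⟩ := circles_spec (w := w) m
  rw [findMask_testBit h1]
  constructor
  · rintro (h | ⟨b, hb, hp, hx⟩)
    · rw [bit_injective h]; exact .refl _ _
    · obtain ⟨z, hz⟩ := h3 b hb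
      obtain ⟨p', hp', hzp⟩ := hz _ hp
      obtain ⟨x', hx', hzx⟩ := hz _ hx
      rw [bit_injective hp'] at hzp
      rw [bit_injective hx'] at hzx
      exact hzx.symm.trans hzp
  · intro h
    -- Transitivity is where disjointness of the masks enters: two masks that share a point are
    -- equal.
    have heq : Equivalence fun x p : Point w => bit x = bit p ∨ ∃ b ∈ circles w m,
        b.testBit (bit p) = true ∧ b.testBit (bit x) = true := by
      refine ⟨fun _ => Or.inl rfl, ?_, ?_⟩
      · rintro x y (h | ⟨b, hb, h⟩)
        · exact Or.inl h.symm
        · exact Or.inr ⟨b, hb, h.symm⟩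
      · rintro x y z (h | ⟨b, hb, hy, hx⟩) (h' | ⟨b', hb', hz, hy'⟩)
        · exact Or.inl (h.trans h')
        · exact Or.inr ⟨b', hb', hz, h ▸ hy'⟩
        · exact Or.inr ⟨b, hb, h' ▸ hy, hx⟩
        · have : b = b' := eq_of_common_testBit h1 hb hb' hy hy'
          subst this
          exact Or.inr ⟨b, hb, hz, hx⟩
    refine SameCircle.le_of_arc heq (fun x y hxy => Or.inr ?_) h
    obtain ⟨b, hb, hx, hy⟩ := h2 x y hxy
    exact ⟨b, hb, hy, hx⟩

end Codes

/-! ### The differential and its transpose on codes. -/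

section Codes

variable {n : ℕ} {w : BraidWord n}

/-- The pair `c` of bit masks describes the generator `S`: the first mask is the set of the
`1`-resolved crossings, the second one the set of the points labelled `v₊`. -/
def Decodes (c : ℕ × ℕ) (S : Generator w) : Prop :=
  S.res = resOf w c.1 ∧ ∀ x, S.label x = c.2.testBit (bit x)

theorem Decodes.unique {c : ℕ × ℕ} {S T : Generator w} (hS : Decodes c S) (hT : Decodes c T) :
    S = T :=
  Generator.ext (hS.1.trans hT.1.symm) (funext fun x => (hS.2 x).trans (hT.2 x).symm)

/-- The labelling given by the code `c` is constant along arcs. -/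
def codeValid (w : BraidWord n) (c : ℕ × ℕ) : Bool :=
  (arcList w c.1).all fun a => c.2.testBit (bit a.1) == c.2.testBit (bit a.2)

theorem exists_decodes {c : ℕ × ℕ} (hc : codeValid w c = true) : ∃ S : Generator w, Decodes c S := by
  refine ⟨⟨resOf w c.1, fun x => c.2.testBit (bit x), fun x y h => ?_⟩, rfl, fun x => rfl⟩
  simpa using List.all_eq_true.1 hc (x, y) (mem_arcList.2 h)

section Relabel

variable {m L : ℕ} {t : Crossing w} {V : Generator w}

open Classical in
theorem setMask_findMask_testBit (L : ℕ) (p : Point w) (b : Bool) (x : Point w) :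
    (setMask L (findMask (circles w m) (bit p)) b).testBit (bit x) =
      if SameCircle (resOf w m) x p then b else L.testBit (bit x) := by
  rw [setMask_testBit]
  by_cases h : SameCircle (resOf w m) x p
  · rw [if_pos h, if_pos ((findMask_circles m p x).2 h)]
  · rw [if_neg h, if_neg (mt (findMask_circles m p x).1 h)]

theorem decodes_setMask_of_same (h : SameCircle (resOf w m) (cornerL t) (cornerR t)) (b : Bool) :
    Decodes (m, setMask L (findMask (circles w m) (bit (cornerL t))) b) V ↔
      V.res = resOf w m ∧ (∀ x, ¬ Near (resOf w m) t x → V.label x = L.testBit (bit x)) ∧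
        V.label (cornerL t) = b := by
  unfold Decodes
  refine and_congr_right fun hres => ?_
  simp only [setMask_findMask_testBit]
  change V.res = resOf w m at hres
  constructor
  · intro hV
    refine ⟨fun x hx => ?_, ?_⟩
    · rw [hV, if_neg fun h => hx (Or.inl h)]
    · rw [hV, if_pos (SameCircle.refl _ _)]
  · rintro ⟨h1, h2⟩ x
    split_ifs with hx
    · rw [SameCircle.label_eq V (hres ▸ hx), h2]
    · refine h1 x ?_
      rintro (h' | h')
      · exact hx h'
      · exact hx (h'.trans h.symm)

theorem decodes_setMask_of_not_same (h : ¬ SameCircle (resOf w m) (cornerL t) (cornerR t))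
    (b b' : Bool) :
    Decodes (m, setMask (setMask L (findMask (circles w m) (bit (cornerL t))) b)
        (findMask (circles w m) (bit (cornerR t))) b') V ↔
      V.res = resOf w m ∧ (∀ x, ¬ Near (resOf w m) t x → V.label x = L.testBit (bit x)) ∧
        V.label (cornerL t) = b ∧ V.label (cornerR t) = b' := by
  unfold Decodes
  refine and_congr_right fun hres => ?_
  simp only [setMask_findMask_testBit]
  change V.res = resOf w m at hres
  constructor
  · intro hV
    refine ⟨fun x hx => ?_, ?_, ?_⟩
    · rw [hV, if_neg fun h => hx (Or.inr h), if_neg fun h => hx (Or.inl h)]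
    · rw [hV, if_neg h, if_pos (SameCircle.refl _ _)]
    · rw [hV, if_pos (SameCircle.refl _ _)]
  · rintro ⟨h1, h2, h3⟩ x
    split_ifs with hx hx'
    · rw [SameCircle.label_eq V (hres ▸ hx), h3]
    · rw [SameCircle.label_eq V (hres ▸ hx'), h2]
    · exact h1 x fun h' => h'.elim hx' hx

end Relabel

open Classical in
/-- The chain with coefficient `1` at the generator described by the code `c`. -/
def ind (w : BraidWord n) (c : ℕ × ℕ) : CKh w := fun S => if Decodes c S then 1 else 0

/-- The chain that is given by a list of codes. -/
def indSum (w : BraidWord n) (l : List (ℕ × ℕ)) : CKh w := (l.map (ind w)).sum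

theorem indSum_nil : indSum w [] = 0 := rfl

theorem indSum_cons (c : ℕ × ℕ) (l : List (ℕ × ℕ)) : indSum w (c :: l) = ind w c + indSum w l := by
  simp [indSum]

theorem indSum_append (l l' : List (ℕ × ℕ)) : indSum w (l ++ l') = indSum w l + indSum w l' := by
  simp [indSum]

theorem indSum_flatMap {α : Type*} (l : List α) (f : α → List (ℕ × ℕ)) :
    indSum w (l.flatMap f) = (l.map fun a => indSum w (f a)).sum := by
  induction l with
  | nil => rfl
  | cons a l ih => rw [List.flatMap_cons, indSum_append, ih, List.map_cons, List.sum_cons]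

theorem indSum_apply_eq_zero {l : List (ℕ × ℕ)} {S : Generator w} (h : ∀ c ∈ l, ¬ Decodes c S) :
    indSum w l S = 0 := by
  induction l with
  | nil => rfl
  | cons c l ih =>
    rw [indSum_cons, Pi.add_apply, ih fun c hc => h c (List.mem_cons_of_mem _ hc), ind,
      if_neg (h c List.mem_cons_self), add_zero]

/-- Remove `c` from the list if it is there, otherwise insert it. -/
def toggle (c : ℕ × ℕ) : List (ℕ × ℕ) → List (ℕ × ℕ)
  | [] => [c]
  | a :: l => if a.1 = c.1 ∧ a.2 = c.2 then l else a :: toggle c l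

/-- Over ℤ/2 a repeated code cancels. Folding with `toggle` thus brings a list of codes to a reduced
form that can be inspected term by term. -/
theorem indSum_toggle (c : ℕ × ℕ) (l : List (ℕ × ℕ)) :
    indSum w (toggle c l) = ind w c + indSum w l := by
  induction l with
  | nil => simp [toggle, indSum_cons]
  | cons a l ih =>
    rw [toggle]
    split_ifs with h
    · rw [indSum_cons, Prod.ext h.1 h.2, ← add_assoc, add_self_eq_zero_of_fun, zero_add]
    · rw [indSum_cons, indSum_cons, ih, add_left_comm]

theorem indSum_foldr_toggle (l : List (ℕ × ℕ)) : indSum w (l.foldr toggle []) = indSum w l := by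
  induction l with
  | nil => rfl
  | cons c l ih => rw [List.foldr_cons, indSum_toggle, ih, indSum_cons]

/-- The codes of the generators in the differential of the generator with code `c`, along the edge
of the cube at the crossing `t`. -/
def succsAt (w : BraidWord n) (c : ℕ × ℕ) (t : Crossing w) : List (ℕ × ℕ) :=
  if c.1.testBit t then [] else
    let m := c.1 ||| 2 ^ t.val
    let p := findMask (circles w m) (bit (cornerL t))
    let q := findMask (circles w m) (bit (cornerR t))
    let b := c.2.testBit (bit (cornerL t))
    let b' := c.2.testBit (bit (cornerR t))
    if p.testBit (bit (cornerR t)) then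
      if b || b' then [(m, setMask c.2 p (b && b'))] else []
    else
      if b then [(m, setMask (setMask c.2 p true) q false), (m, setMask (setMask c.2 p false) q true)]
      else [(m, setMask (setMask c.2 p false) q false)]

/-- The codes of the generators whose differential contains the generator with code `c`, along the
edge of the cube at the crossing `t`. -/
def predsAt (w : BraidWord n) (c : ℕ × ℕ) (t : Crossing w) : List (ℕ × ℕ) :=
  if c.1.testBit t then
    let m := c.1 ^^^ 2 ^ t.val
    let p := findMask (circles w m) (bit (cornerL t))
    let q := findMask (circles w m) (bit (cornerR t))
    let b := c.2.testBit (bit (cornerL t))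
    let b' := c.2.testBit (bit (cornerR t))
    if p.testBit (bit (cornerR t)) then
      if b && b' then [] else [(m, setMask c.2 p (b || b'))]
    else
      if b then [(m, setMask (setMask c.2 p true) q true)]
      else [(m, setMask (setMask c.2 p true) q false), (m, setMask (setMask c.2 p false) q true)]
  else []

theorem resOf_or {m : ℕ} (t : Crossing w) :
    resOf w (m ||| 2 ^ t.val) = Function.update (resOf w m) t true := by
  funext s
  by_cases hs : s = t
  · subst hs; simp [resOf]
  · simp [resOf, Function.update_of_ne hs, Fin.val_ne_of_ne (Ne.symm hs)]

theorem resOf_xor {m : ℕ} {t : Crossing w} (h : m.testBit t = true) :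
    resOf w (m ^^^ 2 ^ t.val) = Function.update (resOf w m) t false := by
  funext s
  by_cases hs : s = t
  · subst hs; simp [resOf, h]
  · simp [resOf, Function.update_of_ne hs, Fin.val_ne_of_ne (Ne.symm hs)]

theorem findMask_corner {m : ℕ} {t : Crossing w} :
    (findMask (circles w m) (bit (cornerL t))).testBit (bit (cornerR t)) = true ↔
      SameCircle (resOf w m) (cornerL t) (cornerR t) := by
  rw [findMask_circles, SameCircle.comm]

open Classical in
theorem indSum_pair_apply {c c' : ℕ × ℕ} {S : Generator w} (h : ¬ (Decodes c S ∧ Decodes c' S)) :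
    indSum w [c, c'] S = if Decodes c S ∨ Decodes c' S then 1 else 0 := by
  rw [indSum_cons, indSum_cons, indSum_nil, add_zero, Pi.add_apply, ind, ind]
  by_cases h1 : Decodes c S <;> by_cases h2 : Decodes c' S <;> simp_all

theorem indSum_singleton (c : ℕ × ℕ) : indSum w [c] = ind w c := by
  rw [indSum_cons, indSum_nil, add_zero]

theorem near_iff_label_iff {m L : ℕ} {t : Crossing w} {I : Resolution w} {V U : Generator w}
    (hd : DifferAt t I (resOf w m)) (hU : ∀ x, U.label x = L.testBit (bit x)) :
    (∀ x, ¬ Near (resOf w m) t x → V.label x = L.testBit (bit x)) ↔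
      ∀ x, ¬ Near I t x → V.label x = U.label x := by
  simp only [hd.near_iff, hU]

-- `succsAt` only computes circles of the target resolution. By `DifferAt.sameCircle_corner_iff`
-- these decide the type of the edge: it is a merge exactly when the corners lie on one circle of
-- the target.
open Classical in
theorem indSum_succsAt {c : ℕ × ℕ} {S : Generator w} (hS : Decodes c S) (t : Crossing w)
    (T : Generator w) : indSum w (succsAt w c t) T = if IncidentAt t S T then 1 else 0 := by
  have hrest : S.res t = c.1.testBit t := by rw [hS.1]; rfl
  have hL := hS.2 (cornerL t)
  have hR := hS.2 (cornerR t)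
  by_cases ht : c.1.testBit t = true
  · rw [succsAt, if_pos ht, indSum_nil, if_neg, Pi.zero_apply]
    intro h
    rw [h.1, ht] at hrest
    cases hrest
  rw [succsAt, if_neg ht]
  rw [Bool.not_eq_true] at ht
  rw [ht] at hrest
  have hm : resOf w (c.1 ||| 2 ^ t.val) = Function.update S.res t true := by rw [resOf_or, hS.1]
  have hd : DifferAt t S.res (resOf w (c.1 ||| 2 ^ t.val)) := by
    rw [hm]; exact (differAt_update (b := true) (by simpa using hrest)).symm
  have hoff := near_iff_label_iff (V := T) hd hS.2
  by_cases hp : SameCircle (resOf w (c.1 ||| 2 ^ t.val)) (cornerL t) (cornerR t)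
  · have hs := hd.symm.sameCircle_corner_iff.1 hp
    simp only [findMask_corner.2 hp, if_true, IncidentAt.merge_iff hs, hL, hR]
    by_cases hb : (c.2.testBit (bit (cornerL t)) || c.2.testBit (bit (cornerR t))) = true
    · rw [if_pos hb, indSum_singleton, ind]
      simp only [decodes_setMask_of_same hp, hoff]
      simp only [hrest, hm, hb, true_and, and_true]
    · rw [if_neg hb, if_neg fun h => hb h.2.2.2, indSum_nil, Pi.zero_apply]
  · have hs := hd.sameCircle_corner_iff.2 hp
    simp only [mt findMask_corner.1 hp, IncidentAt.split_iff hs, hL]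
    rw [if_neg (by simp)]
    by_cases hb : c.2.testBit (bit (cornerL t)) = true
    · rw [if_pos hb, indSum_pair_apply]
      · simp only [decodes_setMask_of_not_same hp, hoff]
        simp only [hrest, hm, hb, true_and]
        refine if_congr ?_ rfl rfl
        cases T.label (cornerL t) <;> cases T.label (cornerR t) <;> simp
      · simp only [decodes_setMask_of_not_same hp]
        rintro ⟨⟨-, -, h, -⟩, -, -, h', -⟩
        rw [h] at h'
        cases h'
    · rw [if_neg hb, indSum_singleton, ind]
      simp only [decodes_setMask_of_not_same hp, hoff]
      rw [Bool.not_eq_true] at hb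
      simp only [hrest, hm, hb, true_and]
      refine if_congr ?_ rfl rfl
      cases T.label (cornerL t) <;> cases T.label (cornerR t) <;> simp

open Classical in
theorem indSum_predsAt {c : ℕ × ℕ} {T : Generator w} (hT : Decodes c T) (t : Crossing w)
    (S : Generator w) : indSum w (predsAt w c t) S = if IncidentAt t S T then 1 else 0 := by
  have hrest : T.res t = c.1.testBit t := by rw [hT.1]; rfl
  have hL := hT.2 (cornerL t)
  have hR := hT.2 (cornerR t)
  have hinc : IncidentAt t S T → T.res t = true ∧ S.res = Function.update T.res t false :=
    fun h => (update_eq_comm false).1 ⟨h.1, h.2.1⟩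
  by_cases ht : c.1.testBit t = true
  swap
  · rw [predsAt, if_neg ht, indSum_nil, if_neg, Pi.zero_apply]
    intro h
    rw [(hinc h).1] at hrest
    exact ht hrest.symm
  rw [predsAt, if_pos ht]
  rw [ht] at hrest
  have hm : resOf w (c.1 ^^^ 2 ^ t.val) = Function.update T.res t false := by
    rw [resOf_xor ht, hT.1]
  have hd : DifferAt t T.res (resOf w (c.1 ^^^ 2 ^ t.val)) := by
    rw [hm]; exact (differAt_update (b := false) (by simpa using hrest)).symm
  have hoff := near_iff_label_iff (V := S) hd hT.2
  by_cases hres : S.res = resOf w (c.1 ^^^ 2 ^ t.val)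
  swap
  · rw [if_neg fun h => hres ((hinc h).2.trans hm.symm)]
    -- Every code listed by `predsAt` has the same first mask, hence the same resolution.
    refine indSum_apply_eq_zero fun c' hc' hS => hres (hS.1.trans ?_)
    congr 1
    revert hc'
    simp only
    split_ifs <;> simp only [List.mem_cons, List.not_mem_nil, or_false] <;> rintro h <;>
      first | exact h.elim | (rw [h]) | (rcases h with h | h <;> rw [h])
  have hres' : S.res t = false ∧ T.res = Function.update S.res t true := by
    refine (update_eq_comm false).2 ⟨hrest, ?_⟩
    rw [hres, hm]
  have hoff' : (∀ x, ¬ Near (resOf w (c.1 ^^^ 2 ^ t.val)) t x → S.label x = c.2.testBit (bit x)) ↔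
      ∀ x, ¬ Near S.res t x → T.label x = S.label x := by
    rw [hres]
    simp only [hT.2, eq_comm]
  by_cases hp : SameCircle (resOf w (c.1 ^^^ 2 ^ t.val)) (cornerL t) (cornerR t)
  · have hs : SameCircle S.res (cornerL t) (cornerR t) := hres ▸ hp
    have hp' := findMask_corner.2 hp
    simp only [hp', if_true, IncidentAt.split_iff hs, hL, hR]
    by_cases hb : (c.2.testBit (bit (cornerL t)) && c.2.testBit (bit (cornerR t))) = true
    · rw [if_pos hb, indSum_nil, if_neg, Pi.zero_apply]
      rw [hb]
      simp
    · rw [if_neg hb, indSum_singleton, ind]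
      rw [Bool.not_eq_true] at hb
      simp only [decodes_setMask_of_same hp, hoff', hb, and_true]
      exact if_congr ⟨fun h => ⟨hres', h.2⟩, fun h => ⟨hres, h.2⟩⟩ rfl rfl
  · have hs : ¬ SameCircle S.res (cornerL t) (cornerR t) := hres ▸ hp
    simp only [mt findMask_corner.1 hp, IncidentAt.merge_iff hs, hL]
    rw [if_neg (by simp)]
    by_cases hb : c.2.testBit (bit (cornerL t)) = true
    · rw [if_pos hb, indSum_singleton, ind]
      simp only [decodes_setMask_of_not_same hp, hoff', hb]
      refine if_congr ?_ rfl rfl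
      rw [and_iff_right hres, and_iff_right hres']
      cases S.label (cornerL t) <;> cases S.label (cornerR t) <;> simp
    · rw [if_neg hb, indSum_pair_apply]
      · rw [Bool.not_eq_true] at hb
        simp only [decodes_setMask_of_not_same hp, hoff', hb]
        refine if_congr ?_ rfl rfl
        rw [and_iff_right hres, and_iff_right hres, and_iff_right hres']
        cases S.label (cornerL t) <;> cases S.label (cornerR t) <;> simp
      · simp only [decodes_setMask_of_not_same hp]
        rintro ⟨⟨-, -, h, -⟩, -, -, h', -⟩
        rw [h] at h'
        cases h'

/-- The codes of the generators in the differential of the generator with code `c`. -/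
def succs (w : BraidWord n) (c : ℕ × ℕ) : List (ℕ × ℕ) := (List.finRange w.length).flatMap (succsAt w c)

/-- The codes of the generators whose differential contains the generator with code `c`. -/
def preds (w : BraidWord n) (c : ℕ × ℕ) : List (ℕ × ℕ) := (List.finRange w.length).flatMap (predsAt w c)

theorem indSum_flatMap_finRange_apply (f : Crossing w → List (ℕ × ℕ)) (S : Generator w) :
    indSum w ((List.finRange w.length).flatMap f) S = ∑ t, indSum w (f t) S := by
  rw [indSum_flatMap, ← Finset.sum_apply, Fin.sum_univ_def]

theorem ind_eq_single [DecidableEq (Generator w)] {c : ℕ × ℕ} {S : Generator w} (hS : Decodes c S) :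
    ind w c = Pi.single S 1 := by
  classical
  funext T
  rw [ind, Pi.single_apply]
  refine if_congr ⟨fun h => h.unique hS, ?_⟩ rfl rfl
  rintro rfl
  exact hS

/-- Validity matters: an invalid code gives the zero chain, while its list of successors need not be
empty. -/
theorem diff_ind {c : ℕ × ℕ} (hc : codeValid w c = true) : diff w (ind w c) = indSum w (succs w c) := by
  classical
  obtain ⟨S, hS⟩ := exists_decodes hc
  funext T
  rw [diff_apply, succs, indSum_flatMap_finRange_apply]
  refine Finset.sum_congr rfl fun t _ => ?_
  rw [indSum_succsAt hS, ind_eq_single hS, Finset.sum_pi_single']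
  simp

theorem diff_indSum {l : List (ℕ × ℕ)} (hl : l.all (codeValid w) = true) :
    diff w (indSum w l) = indSum w (l.flatMap (succs w)) := by
  induction l with
  | nil => simp [indSum_nil]
  | cons c l ih =>
    rw [List.all_cons, Bool.and_eq_true] at hl
    rw [indSum_cons, map_add, diff_ind hl.1, ih hl.2, List.flatMap_cons, indSum_append]

/-- The list `preds` is a row of the matrix of d, so it computes the transpose of d with respect to
the basis of generators. -/
theorem ind_dotProduct_diff {c : ℕ × ℕ} (hc : codeValid w c = true) (y : CKh w) :
    ind w c ⬝ᵥ diff w y = indSum w (preds w c) ⬝ᵥ y := by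
  classical
  obtain ⟨T, hT⟩ := exists_decodes hc
  rw [ind_eq_single hT, single_dotProduct, one_mul, diff_apply]
  simp only [dotProduct, preds, indSum_flatMap_finRange_apply, indSum_predsAt hT, Finset.sum_mul]
  rw [Finset.sum_comm]
  refine Finset.sum_congr rfl fun t _ => ?_
  simp [Finset.sum_filter]

theorem indSum_dotProduct_diff {l : List (ℕ × ℕ)} (hl : l.all (codeValid w) = true) (y : CKh w) :
    indSum w l ⬝ᵥ diff w y = indSum w (l.flatMap (preds w)) ⬝ᵥ y := by
  induction l with
  | nil => simp [indSum_nil]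
  | cons c l ih =>
    rw [List.all_cons, Bool.and_eq_true] at hl
    rw [indSum_cons, add_dotProduct, ind_dotProduct_diff hl.1, ih hl.2, List.flatMap_cons,
      indSum_append, add_dotProduct]

end Codes

/-! ### The two gradings of a code. -/

section Gradings

variable {n : ℕ} {w : BraidWord n}

/-- The number of `1`-resolved crossings of a code. -/
def codeH (w : BraidWord n) (c : ℕ × ℕ) : ℕ := (List.finRange w.length).countP fun t => c.1.testBit t.val

theorem countP_finRange (m : ℕ) (p : Fin m → Bool) :
    (List.finRange m).countP p = {i : Fin m | p i = true}.ncard := by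
  rw [List.countP_eq_length_filter, ← List.toFinset_card_of_nodup ((List.nodup_finRange m).filter p),
    ← Set.ncard_coe_finset]
  congr 1
  ext i
  simp

theorem Decodes.h_eq {c : ℕ × ℕ} {S : Generator w} (hS : Decodes c S) : S.h = codeH w c := by
  unfold Generator.h codeH
  rw [hS.1, countP_finRange]
  rfl

/-- The marked point on the closing arc of the strand position `j`. -/
def lastPoint (w : BraidWord n) (j : Fin n) : Point w := (Fin.last w.length, j)

-- Each non-trivial circle is counted once, at the smallest strand position whose closing arc it
-- contains.
open Classical in
theorem ncard_nontrivial_label (S : Generator w) (b : Bool) :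
    ({c : Circle S.res | c.Nontrivial ∧ S.circleLabel c = b}.ncard : ℤ) =
      ∑ j : Fin n, if (∀ i, i < j → ¬ SameCircle S.res (lastPoint w i) (lastPoint w j)) ∧
        Odd {i | SameCircle S.res (lastPoint w i) (lastPoint w j)}.ncard ∧
        S.label (lastPoint w j) = b then 1 else 0 := by
  rw [Finset.sum_boole, ← Set.ncard_coe_finset]
  congr 1
  symm
  have heq : ∀ i j : Fin n, ((⟦lastPoint w i⟧ : Circle S.res) = ⟦lastPoint w j⟧) ↔
      SameCircle S.res (lastPoint w i) (lastPoint w j) := fun i j => Quotient.eq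
  refine Set.ncard_congr (fun j _ => (⟦lastPoint w j⟧ : Circle S.res)) ?_ ?_ ?_
  · intro j hj
    simp only [Finset.coe_filter, Finset.mem_univ, true_and, Set.mem_ofPred_eq] at hj
    refine ⟨?_, hj.2.2⟩
    have := hj.2.1
    simp only [← heq] at this
    exact this
  · intro i j hi hj hij
    simp only [Finset.coe_filter, Finset.mem_univ, true_and, Set.mem_ofPred_eq] at hi hj
    rw [heq] at hij
    rcases lt_trichotomy i j with h | h | h
    · exact absurd hij (hj.1 i h)
    · exact h
    · exact absurd hij.symm (hi.1 j h)
  · rintro c ⟨hc, hb⟩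
    obtain ⟨j₀, hj₀⟩ := Set.nonempty_of_ncard_ne_zero hc.pos.ne'
    have hex : ∃ j, (⟦lastPoint w j⟧ : Circle S.res) = c := ⟨j₀, hj₀⟩
    obtain ⟨j, hj, hmin⟩ := WellFounded.has_min (wellFounded_lt (α := Fin n))
      {j | (⟦lastPoint w j⟧ : Circle S.res) = c} hex
    change (⟦lastPoint w j⟧ : Circle S.res) = c at hj
    refine ⟨j, ?_, hj⟩
    subst hj
    simp only [Finset.coe_filter, Finset.mem_univ, true_and, Set.mem_ofPred_eq]
    refine ⟨fun i hi h => hmin i ((heq i j).2 h) hi, ?_, hb⟩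
    simp only [← heq]
    exact hc

/-- The annular grading of a code. -/
def codeK (w : BraidWord n) (c : ℕ × ℕ) : ℤ :=
  ((List.finRange n).map fun j =>
    let m := findMask (circles w c.1) (bit (lastPoint w j))
    if ((List.finRange n).all fun i => !(decide (i < j) && m.testBit (bit (lastPoint w i)))) &&
      decide (((List.finRange n).countP fun i => m.testBit (bit (lastPoint w i))) % 2 = 1) then
      if c.2.testBit (bit (lastPoint w j)) then 1 else -1
    else 0).sum

theorem Decodes.k_eq {c : ℕ × ℕ} {S : Generator w} (hS : Decodes c S) : S.k = codeK w c := by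
  classical
  unfold Generator.k codeK
  rw [ncard_nontrivial_label, ncard_nontrivial_label, ← Finset.sum_sub_distrib, ← Fin.sum_univ_def]
  refine Finset.sum_congr rfl fun j _ => ?_
  simp only [countP_finRange, findMask_circles, ← hS.2, ← hS.1, ← Nat.odd_iff, Bool.and_eq_true,
    List.all_eq_true, List.mem_finRange, true_imp_iff, Bool.not_eq_true', Bool.and_eq_false_imp,
    decide_eq_true_eq]
  have hfalse : ∀ i, (findMask (circles w c.1) (bit (lastPoint w j))).testBit (bit (lastPoint w i)) =
      false ↔ ¬ SameCircle S.res (lastPoint w i) (lastPoint w j) := by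
    intro i
    rw [← Bool.not_eq_true, findMask_circles, hS.1]
  simp only [hfalse]
  by_cases h1 : ∀ i, i < j → ¬ SameCircle S.res (lastPoint w i) (lastPoint w j)
  · by_cases h2 : Odd {i | SameCircle S.res (lastPoint w i) (lastPoint w j)}.ncard
    · simp only [and_iff_right h1, and_iff_right h2, if_pos h2]
      cases S.label (lastPoint w j) <;> simp
    · simp [h2]
  · rw [if_neg fun h => h1 h.1, if_neg fun h => h1 h.1, if_neg fun h => h1 h.1, sub_zero]

theorem indSum_mem_spanOf {l : List (ℕ × ℕ)} {P : Generator w → Prop}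
    (h : ∀ c ∈ l, ∀ S, Decodes c S → P S) : indSum w l ∈ spanOf P :=
  fun _ hS => indSum_apply_eq_zero fun c hc hcS => hS (h c hc _ hcS)

theorem indSum_mem_filt {l : List (ℕ × ℕ)} {i : ℤ} (h : (l.all fun c => decide (codeK w c ≤ i)) = true) :
    indSum w l ∈ filt w i :=
  indSum_mem_spanOf fun c hc S hS => by
    rw [hS.k_eq]
    simpa using List.all_eq_true.1 h c hc

theorem indSum_mem_CKhDeg {l : List (ℕ × ℕ)} {h : ℕ} (hl : (l.all fun c => codeH w c == h) = true) :
    indSum w l ∈ CKhDeg w h :=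
  indSum_mem_spanOf fun c hc S hS => by
    rw [hS.h_eq]
    simpa using List.all_eq_true.1 hl c hc

/-- The two chains have disjoint supports, separated by the annular grading. -/
theorem indSum_dotProduct_eq_zero {l : List (ℕ × ℕ)} {i : ℤ}
    (hl : (l.all fun c => decide (i < codeK w c)) = true) {y : CKh w} (hy : y ∈ filt w i) :
    indSum w l ⬝ᵥ y = 0 := by
  refine Finset.sum_eq_zero fun S _ => ?_
  by_cases hS : S.k ≤ i
  · rw [indSum_apply_eq_zero, zero_mul]
    intro c hc hcS
    have := List.all_eq_true.1 hl c hc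
    rw [decide_eq_true_eq, ← hcS.k_eq] at this
    omega
  · rw [hy S hS, mul_zero]

end Gradings

/-! ### The dual certificate for ψ. -/

section PsiCode

variable {n : ℕ} {w : BraidWord n}

/-- The resolution with the mask `m` is braidlike. -/
def isBraidlike (w : BraidWord n) (m : ℕ) : Bool :=
  (List.finRange w.length).all fun t => m.testBit t.val == !(w.get t).2

theorem isBraidlike_iff (m : ℕ) : isBraidlike w m = true ↔ (psiGen w).res = resOf w m := by
  rw [isBraidlike, List.all_eq_true, funext_iff]
  simp only [List.mem_finRange, true_imp_iff, beq_iff_eq]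
  exact forall_congr' fun t => eq_comm

theorem psi_eq_ind {m : ℕ} (hm : isBraidlike w m = true) : psi w = ind w (m, 0) := by
  classical
  have h : Decodes (m, 0) (psiGen w) :=
    ⟨(isBraidlike_iff m).1 hm, fun x => (Nat.zero_testBit (bit x)).symm⟩
  rw [ind_eq_single h]
  unfold psi
  congr

/-- A dual certificate: a chain `φ` whose pairing with `ψ` is non-zero, while the adjoint
differential of `φ` only involves generators with `k > i`. -/
theorem psi_notMem_map_filt {m : ℕ} {l : List (ℕ × ℕ)} {i : ℤ} (hm : isBraidlike w m = true)
    (hl : (l.all fun c => !isBraidlike w c.1) = true)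
    (hv : ((m, 0) :: l).all (codeValid w) = true)
    (hk : (((((m, 0) :: l).flatMap (preds w)).foldr toggle []).all
      fun c => decide (i < codeK w c)) = true) :
    psi w ∉ (filt w i).map (diff w) := by
  classical
  rintro ⟨y, hy, hdy⟩
  -- Pair φ with d y = ψ. The transposed side vanishes, by the grading of d*φ. The direct side is 1,
  -- because ψ occurs once in φ and no other term of φ has the braidlike resolution.
  have h1 := indSum_dotProduct_diff hv y
  rw [← indSum_foldr_toggle (((m, 0) :: l).flatMap (preds w)), indSum_dotProduct_eq_zero hk hy, hdy,
    indSum_cons, ← psi_eq_ind hm, psi, dotProduct_single, mul_one, Pi.add_apply, Pi.single_eq_same,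
    indSum_apply_eq_zero, add_zero] at h1
  · exact one_ne_zero h1
  · intro c hc h
    have := List.all_eq_true.1 hl c hc
    rw [(isBraidlike_iff _).2 h.1] at this
    cases this

end PsiCode

/-! ### The explicit certificates for A(0,0). -/

/-- The braid word `A(0,0)`. -/
def wordA : BraidWord 4 :=
  [(2, true), (1, false), (1, false), (2, true), (2, true), (1, true), (2, false), (0, false),
    (1, true), (0, true), (0, true)]

theorem braidA_zero_zero : braidA 0 0 = wordA := rfl

/-- The codes of the terms of a chain in `𝓕₀` whose boundary is `ψ`. -/
def boundingCodes : List (ℕ × ℕ) :=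
  -- Only the mask 194 is contained in the braidlike mask 198. The generator (194, 0) produces ψ
  -- through v₋ ↦ v₋v₋ at crossing 2, counted from 0; the other ten terms serve to cancel the rest
  -- of its boundary.
  [(161, 225179766620172), (194, 0), (224, 112589983973478), (296, 0), (304, 0), (321, 0),
    (352, 150119987579016), (416, 150147468658824), (448, 112562502893670), (704, 0), (1216, 0)]

/-- The codes of the terms, besides `ψ`, of a cochain that vanishes on the boundaries of `𝓕₋₁`. -/
def dualCodes : List (ℕ × ℕ) :=
  -- The non-zero label masks mark single trivial circles, so no v₊ here contributes to k.
  [(135, 0), (153, 786432), (163, 0), (165, 0), (169, 0), (226, 0), (228, 0), (232, 0),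
    (408, 786432), (456, 0), (480, 27481079808), (582, 0), (610, 0), (612, 0), (616, 0)]

/-- 198 = 2 + 4 + 64 + 128 marks the four negative crossings 1, 2, 6 and 7, counted from 0. -/
theorem isBraidlike_wordA : isBraidlike wordA 198 = true := by decide +kernel

theorem diff_boundingChain : diff wordA (indSum wordA boundingCodes) = psi wordA := by
  rw [psi_eq_ind isBraidlike_wordA, diff_indSum (by decide +kernel), ← indSum_foldr_toggle,
    show (boundingCodes.flatMap (succs wordA)).foldr toggle [] = [(198, 0)] by decide +kernel,
    indSum_singleton]

theorem psi_wordA_notMem : psi wordA ∉ (filt wordA (-1)).map (diff wordA) :=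
  psi_notMem_map_filt (l := dualCodes) isBraidlike_wordA (by decide +kernel) (by decide +kernel)
    (by decide +kernel)

end AnnularKhovanov

end

theorem mainTheorem8 :
    AnnularKhovanov.kappa (AnnularKhovanov.braidA 0 0) = ((4 : ℤ) : WithTop ℤ) ∧
    (∃ hE : AnnularKhovanov.psi (AnnularKhovanov.braidA 0 0) ∈
        AnnularKhovanov.pageNum (AnnularKhovanov.braidA 0 0) 3 4 (-4),
      (Submodule.Quotient.mk ⟨AnnularKhovanov.psi (AnnularKhovanov.braidA 0 0), hE⟩ :
        AnnularKhovanov.Page (AnnularKhovanov.braidA 0 0) 3 4 (-4)) ≠ 0) ∧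
    (∃ hK : AnnularKhovanov.psi (AnnularKhovanov.braidA 0 0) ∈
        AnnularKhovanov.cycles (AnnularKhovanov.braidA 0 0) 4,
      (Submodule.Quotient.mk ⟨AnnularKhovanov.psi (AnnularKhovanov.braidA 0 0), hK⟩ :
        AnnularKhovanov.Kh (AnnularKhovanov.braidA 0 0) 4) = 0) ∧
    IsEmpty (AnnularKhovanov.Kh (AnnularKhovanov.braidA 0 0) 4 ≃ₗ[ZMod 2]
      DirectSum (Finset.Icc (-4 : ℤ) 4)
        (fun m => AnnularKhovanov.Page (AnnularKhovanov.braidA 0 0) 3 4 (m : ℤ))) ∧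
    ¬ AnnularKhovanov.CollapsesAt (AnnularKhovanov.braidA 0 0) 3 := by
  rw [AnnularKhovanov.braidA_zero_zero]
  refine AnnularKhovanov.consequences_of_psi_boundary _
    (AnnularKhovanov.indSum_mem_filt (l := AnnularKhovanov.boundingCodes) (by decide +kernel))
    (AnnularKhovanov.indSum_mem_CKhDeg (h := 3) (by decide +kernel))
    AnnularKhovanov.diff_boundingChain ?_ ?_ AnnularKhovanov.psi_wordA_notMem
  · rw [AnnularKhovanov.psi_eq_ind AnnularKhovanov.isBraidlike_wordA,
      ← AnnularKhovanov.indSum_singleton]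
    exact AnnularKhovanov.indSum_mem_filt (by decide +kernel)
  · rw [AnnularKhovanov.psi_eq_ind AnnularKhovanov.isBraidlike_wordA,
      ← AnnularKhovanov.indSum_singleton]
    exact AnnularKhovanov.indSum_mem_CKhDeg (h := 4) (by decide +kernel)
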